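/- Let $0\le l\le q$ be integers, let $U=\{z\in\mathbb{C}^q : |z_k|<1 \text{ for } k=1,\dots,q\}$ be the unit polydisc, and let $D=\bigcup_{k=1}^{l}\{z\in U : z_k=0\}$. For $x\in D$ put $K_x=\{k\le l : x_k=0\}$ (the branches of $D$ through $x$), and near $x$ put $d\zeta_k=dz_k/(z_k\ln|z_k|)$ if $k\in K_x$ and $d\zeta_k=dz_k$ otherwise. *Log-log growth.* A function $f$ on $U\setminus D$ has log-log growth along $D$ if for every $x\in D$ there are $C>0$, $p\in\mathbb{N}$ and a neighbourhood $V$ of $x$ with $$|f(z)|\le C\prod_{k\in K_x}\bigl(\ln|\ln|z_k||\bigr)^p+C\qquad (z\in V\setminus D).$$ A smooth $(1,1)$-form $\alpha$ on $U\setminus D$ has log-log growth along $D$ if near every $x\in D$ its coefficients in the frame $d\zeta_j\wedge\overline{d\zeta_k}$ satisfy bounds of this form. A $(1,1)$-current $T$ on $U\setminus D$ has log-log growth along $D$ if it is represented by a form with coefficients in $L^1_{\rm loc}(U\setminus D)$ and $-\alpha\le T\le\alpha$ for some smooth $(1,1)$-form $\alpha$ on $U\setminus D$ with log-log growth along $D$;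 here a form $\sqrt{-1}\sum h_{jk}\,dz_j\wedge d\bar z_k$ is $\ge 0$ if the matrix $(h_{jk})$ is Hermitian positive semidefinite almost everywhere. For a function or form on $U\setminus D$ whose extension by zero to $U$ has locally integrable coefficients on $U$, let $[\,\cdot\,]_{L^1}$ denote the current on $U$ given by integration against this extension. **Proposition.** Let $\phi:U\setminus D\to\mathbb{R}$ be a continuous function with log-log growth along $D$, and let $[\phi]$ be the induced current on $U\setminus D$. Suppose that the current $$T:=\frac{\partial\overline{\partial}[\phi]}{2\pi\sqrt{-1}}$$ on $U\setminus D$ has log-log growth along $D$. Then $\phi$ and the coefficients of $T$, extended by zero, are locally integrable on $U$, and the following identity of currents holds on all of $U$: $$\frac{\partial\overline{\partial}[\phi]_{L^1}}{2\pi\sqrt{-1}}=[T]_{L^1}.$$ -/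

import Mathlib

open MeasureTheory Set Filter Topology TopologicalSpace
open scoped Distributions LineDeriv ContDiff ComplexOrder

noncomputable section

namespace LogLogCurrents

/-- The unit polydisc `{|z_k| < 1 for all k}` in `ℂ^q`. -/
def polydisc (q : ℕ) : Opens (Fin q → ℂ) :=
  ⟨{z | ∀ k, ‖z k‖ < 1}, by
    simp only [Set.ofPred_forall]
    exact isOpen_iInter_of_finite fun k =>
      isOpen_lt (continuous_norm.comp (continuous_apply k)) continuous_const⟩

/-- The union of the first `l` coordinate hyperplanes `{z_k = 0}` in `ℂ^q`. -/
def hyperplanes (q l : ℕ) : Set (Fin q → ℂ) := {z | ∃ k : Fin q, (k : ℕ) < l ∧ z k = 0}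

theorem isClosed_hyperplanes (q l : ℕ) : IsClosed (hyperplanes q l) := by
  have h : hyperplanes q l = ⋃ k : Fin q, {z | (k : ℕ) < l ∧ z k = 0} := by
    ext z; simp [hyperplanes]
  rw [h]
  refine isClosed_iUnion_of_finite fun k => ?_
  by_cases hk : (k : ℕ) < l
  · simpa [hk] using isClosed_eq (continuous_apply k) continuous_const
  · simp [hk]

/-- `U ∖ D`: the polydisc with the normal crossing divisor `D = {z_1 ⋯ z_l = 0}` removed. -/
def puncturedPolydisc (q l : ℕ) : Opens (Fin q → ℂ) :=
  ⟨polydisc q \ hyperplanes q l, (polydisc q).isOpen.sdiff (isClosed_hyperplanes q l)⟩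

/-! ### Currents of bidegree (0,0), (0,1) and (1,1)

A current of bidegree `(a,b)` on an open set `Ω ⊆ ℂ^q` is a differential form of bidegree `(a,b)`
whose coefficients are complex distributions on `Ω`. -/

/-- Currents of bidegree `(0,0)`, i.e. complex distributions. -/
abbrev Current00 {q : ℕ} (Ω : Opens (Fin q → ℂ)) := 𝓓'(Ω, ℂ)

/-- Currents of bidegree `(0,1)`: the family `u` stands for `∑ k, u k dz̄_k`. -/
abbrev Current01 {q : ℕ} (Ω : Opens (Fin q → ℂ)) := Fin q → 𝓓'(Ω, ℂ)

/-- Currents of bidegree `(1,1)`: the family `T` stands for `∑ j k, T j k dz_j ∧ dz̄_k`. -/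
abbrev Current11 {q : ℕ} (Ω : Opens (Fin q → ℂ)) := Fin q → Fin q → 𝓓'(Ω, ℂ)

variable {q : ℕ} {Ω : Opens (Fin q → ℂ)}

/-- `∂/∂z_j = (∂/∂x_j - i ∂/∂y_j) / 2` on distributions, where `z_j = x_j + i y_j`. -/
def wirtinger (j : Fin q) (u : 𝓓'(Ω, ℂ)) : 𝓓'(Ω, ℂ) :=
  (1 / 2 : ℂ) • (∂_{(Pi.single j 1 : Fin q → ℂ)} u
    - Complex.I • ∂_{(Pi.single j Complex.I : Fin q → ℂ)} u)

/-- `∂/∂z̄_k = (∂/∂x_k + i ∂/∂y_k) / 2` on distributions. -/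
def wirtingerBar (k : Fin q) (u : 𝓓'(Ω, ℂ)) : 𝓓'(Ω, ℂ) :=
  (1 / 2 : ℂ) • (∂_{(Pi.single k 1 : Fin q → ℂ)} u
    + Complex.I • ∂_{(Pi.single k Complex.I : Fin q → ℂ)} u)

/-- `∂̄ u = ∑ k, (∂u/∂z̄_k) dz̄_k`. -/
def delBar (u : Current00 Ω) : Current01 Ω := fun k => wirtingerBar k u

/-- `∂ (∑ k, u_k dz̄_k) = ∑ j k, (∂u_k/∂z_j) dz_j ∧ dz̄_k`. -/
def del (u : Current01 Ω) : Current11 Ω := fun j k => wirtinger j (u k)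

/-- The distribution `χ ↦ ∫ χ f` on `Ω` given by a function `f`. It is the intended one
when `f` is locally integrable on `Ω` (and zero by convention otherwise). -/
def ofFunction (Ω : Opens (Fin q → ℂ)) (f : (Fin q → ℂ) → ℂ) : Current00 Ω :=
  TestFunction.integralAgainstBilinCLM (ContinuousLinearMap.lsmul ℝ ℝ : ℝ →L[ℝ] ℂ →L[ℝ] ℂ) volume f

/-- The `(1,1)`-current `T` on `Ω` is the integration against the form
`∑ j k, t j k dz_j ∧ dz̄_k`, whose coefficients are locally integrable on `Ω`. -/
def IsRepresentedBy (T : Current11 Ω) (t : (Fin q → ℂ) → Matrix (Fin q) (Fin q) ℂ) : Prop :=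
  ∀ j k, LocallyIntegrableOn (fun z => t z j k) Ω ∧ T j k = ofFunction Ω fun z => t z j k

/-- `S` is the trivial `L¹`-extension to `Ω` of the `(1,1)`-current `T` on `Ω' ⊆ Ω`: the current
`T` is given by a form with locally integrable coefficients on `Ω'`, and the extension by zero of
any such form has locally integrable coefficients on `Ω` and represents `S`. -/
def IsL1Extension {Ω' : Opens (Fin q → ℂ)} (T : Current11 Ω') (S : Current11 Ω) : Prop :=
  (∃ t, IsRepresentedBy T t) ∧
    ∀ t, IsRepresentedBy T t → IsRepresentedBy S ((Ω' : Set (Fin q → ℂ)).indicator t)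

/-- The form `∑ j k, a j k dz_j ∧ dz̄_k` is positive at a point: writing it as
`i ∑ j k, h j k dz_j ∧ dz̄_k`, the matrix `h = -i a` is Hermitian positive semidefinite. -/
def IsPositive (a : Matrix (Fin q) (Fin q) ℂ) : Prop := (-Complex.I • a).PosSemidef

/-! ### Log-log growth -/

open scoped Classical in
/-- Near the point `x`, off the divisor, `|f(z)| ≤ C ∏ (log |log |z_k||)^p + C`, the product being
over the branches `{z_k = 0}` of the divisor that pass through `x`. -/
def LogLogBoundAt (l : ℕ) (x : Fin q → ℂ) (f : (Fin q → ℂ) → ℂ) : Prop :=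
  ∃ C > (0 : ℝ), ∃ p : ℕ, ∀ᶠ z in 𝓝[(hyperplanes q l)ᶜ] x,
    ‖f z‖ ≤ C * (∏ k ∈ Finset.univ.filter (fun k : Fin q => (k : ℕ) < l ∧ x k = 0),
      Real.log |Real.log ‖z k‖| ^ p) + C

/-- A function on `U ∖ D` has log-log growth along `D`. -/
def FunctionHasLogLogGrowth (l : ℕ) (f : (Fin q → ℂ) → ℂ) : Prop :=
  ∀ x ∈ (polydisc q : Set (Fin q → ℂ)) ∩ hyperplanes q l, LogLogBoundAt l x f

open scoped Classical in
/-- The function `w_k` with `dz_k = w_k dζ_k` near `x`, where `dζ_k = dz_k / (z_k log |z_k|)` if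
`{z_k = 0}` is a branch of the divisor through `x`, and `dζ_k = dz_k` otherwise. -/
def zetaFactor (l : ℕ) (x z : Fin q → ℂ) (k : Fin q) : ℂ :=
  if (k : ℕ) < l ∧ x k = 0 then z k * (Real.log ‖z k‖ : ℂ) else 1

/-- The form `∑ j k, a j k dz_j ∧ dz̄_k` is smooth on `U ∖ D` and has log-log growth along `D`:
near each point of `D` its coefficients in the frame `dζ_j ∧ conj dζ_k` are bounded in the
log-log sense. -/
def FormHasLogLogGrowth (l : ℕ) (a : (Fin q → ℂ) → Matrix (Fin q) (Fin q) ℂ) : Prop :=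
  (∀ j k, ContDiffOn ℝ ∞ (fun z => a z j k) (puncturedPolydisc q l)) ∧
    ∀ x ∈ (polydisc q : Set (Fin q → ℂ)) ∩ hyperplanes q l, ∀ j k,
      LogLogBoundAt l x fun z =>
        a z j k * zetaFactor l x z j * (starRingEnd ℂ) (zetaFactor l x z k)

/-- The `(1,1)`-current `T` on `U ∖ D` has log-log growth along `D`: it is represented by a form
`t` with locally integrable coefficients, and `-a ≤ t ≤ a` almost everywhere for some smooth
`(1,1)`-form `a` with log-log growth along `D`. -/
def CurrentHasLogLogGrowth {l : ℕ} (T : Current11 (puncturedPolydisc q l)) : Prop :=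
  ∃ t a : (Fin q → ℂ) → Matrix (Fin q) (Fin q) ℂ, IsRepresentedBy T t ∧ FormHasLogLogGrowth l a ∧
    ∀ᵐ z ∂volume.restrict (puncturedPolydisc q l : Set (Fin q → ℂ)),
      IsPositive (a z - t z) ∧ IsPositive (t z + a z)

end LogLogCurrents

end

/-! Multiply a test function `η` on `U` by a cutoff `χ_N` vanishing near `D`. Since `η χ_N` is a
test function on `U ∖ D`, the definition of `T` gives `∫ η χ_N t = c ∫ ∂∂̄(η χ_N) φ`
coefficientwise, and it remains to let `N → ∞` by dominated convergence on both sides.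

The cutoff in each branch variable is a smooth step function of `log |ζ| / N`. Its first derivatives
are `O(1 / (N |ζ|))` on the annulus where `-log |ζ|` lies between `N` and `2N`, hence are bounded by
a multiple of the Poincaré-type weight `1 / (|ζ| (1 - log |ζ|))`, uniformly in `N`. A single second
derivative would also contribute a term of order `1 / (N |ζ|²)`, which is not controlled by the
square of that weight. Only the Laplacian occurs in `∂²/∂ζ∂ζ̄`, however, and there this term drops
out because `log |ζ|` is harmonic (`laplacian_logCutoff`). So `∂∂̄(η χ_N)` is bounded by a constant
times the product of the squared weights (`exists_bound_mixedDeriv_mul_divisorCutoff`).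

Log-log growth is absorbed by `∏ (1 - log |z_i|)^(1/2)`. In polar coordinates the combined weight
becomes `1 / (r (1 - log r)^(3/2))`, which is integrable at `0`. This dominates the right-hand side.
On the left, `-a ≤ t ≤ a` bounds every entry of `t` by the diagonal of `a`
(`norm_apply_le_of_isPositive`), and rewriting that diagonal in the coordinate frame costs at most
the same squared weights. -/

noncomputable section

namespace LogLogCurrents

/-! ### Logarithmic weights on the unit disc -/

/-- The weight `1 - log |ζ|`, which is at least `1` on the unit disc. -/
def logWeight (ζ : ℂ) : ℝ := 1 - Real.log ‖ζ‖

/-- The weight `1 / (|ζ| (1 - log |ζ|))`, with value `1` at the origin. -/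
def cuspWeight (ζ : ℂ) : ℝ := if ζ = 0 then 1 else (‖ζ‖ * logWeight ζ)⁻¹

/-- The product of the weights `(1 - log |z_i|) ^ (1/2)`. -/
def logWeightProd {q : ℕ} (z : Fin q → ℂ) : ℝ := ∏ i, √(logWeight (z i))

/-- The product of the squares of the weights `cuspWeight`. -/
def cuspWeightProd {q : ℕ} (z : Fin q → ℂ) : ℝ := ∏ i, cuspWeight (z i) ^ 2

theorem one_le_logWeight {ζ : ℂ} (h : ‖ζ‖ < 1) : 1 ≤ logWeight ζ := by
  have := Real.log_nonpos (norm_nonneg ζ) h.le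
  unfold logWeight; linarith

theorem one_le_cuspWeight {ζ : ℂ} (h : ‖ζ‖ < 1) : 1 ≤ cuspWeight ζ := by
  unfold cuspWeight
  split_ifs with h0
  · exact le_rfl
  have hr : 0 < ‖ζ‖ := norm_pos_iff.2 h0
  have hL := one_le_logWeight h
  refine (one_le_inv₀ (by positivity)).2 ?_
  -- Applied to `1/r`, this reads `1 - log r ≤ 1/r`, that is `r (1 - log r) ≤ 1`.
  have h1 := Real.log_le_sub_one_of_pos (inv_pos.2 hr)
  rw [Real.log_inv] at h1
  have h2 : logWeight ζ ≤ ‖ζ‖⁻¹ := by unfold logWeight; linarith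
  calc ‖ζ‖ * logWeight ζ ≤ ‖ζ‖ * ‖ζ‖⁻¹ := by gcongr
    _ = 1 := mul_inv_cancel₀ hr.ne'

theorem one_le_logWeightProd {q : ℕ} {z : Fin q → ℂ} (hz : z ∈ polydisc q) :
    1 ≤ logWeightProd z := by
  refine Finset.one_le_prod fun i _ => ?_
  rw [Real.one_le_sqrt]
  exact one_le_logWeight (hz i)

theorem one_le_cuspWeightProd {q : ℕ} {z : Fin q → ℂ} (hz : z ∈ polydisc q) :
    1 ≤ cuspWeightProd z :=
  Finset.one_le_prod fun i _ => one_le_pow₀ (one_le_cuspWeight (hz i))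

theorem cuspWeightProd_nonneg {q : ℕ} (z : Fin q → ℂ) : 0 ≤ cuspWeightProd z :=
  Finset.prod_nonneg fun _ _ => sq_nonneg _

theorem measurable_logWeight : Measurable logWeight :=
  measurable_const.sub (Real.measurable_log.comp measurable_norm)

theorem measurable_cuspWeight : Measurable cuspWeight :=
  Measurable.ite (measurableSet_singleton 0) measurable_const
    (measurable_norm.mul measurable_logWeight).inv

theorem measurable_cuspWeightProd {q : ℕ} : Measurable (cuspWeightProd (q := q)) :=
  Finset.measurable_prod _ fun i _ =>
    (measurable_cuspWeight.comp (measurable_pi_apply i)).pow_const 2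

theorem hasDerivAt_two_div_sqrt_one_sub_log {r : ℝ} (h0 : 0 < r) (h1 : r < 1) :
    HasDerivAt (fun r => 2 / √(1 - Real.log r))
      (r * (√(1 - Real.log r) * ((r * (1 - Real.log r))⁻¹) ^ 2)) r := by
  have hu : 0 < 1 - Real.log r := by linarith [Real.log_neg h0 h1]
  have hs : 0 < √(1 - Real.log r) := Real.sqrt_pos.2 hu
  have h := (((Real.hasDerivAt_log h0.ne').const_sub 1).sqrt hu.ne').fun_inv hs.ne'
  have h' := h.const_mul 2
  simp only [← div_eq_mul_inv] at h'
  refine h'.congr_deriv ?_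
  rw [Real.sq_sqrt hu.le]
  field_simp
  rw [Real.sq_sqrt hu.le]

theorem integrableOn_sqrt_logWeight_mul_cuspWeight_sq :
    IntegrableOn (fun ζ => √(logWeight ζ) * cuspWeight ζ ^ 2) (Metric.ball 0 1) := by
  have key := integrableOn_fun_norm_addHaar (volume : Measure ℂ) (r := 1)
    (f := fun r : ℝ => √(1 - Real.log r) * (if r = 0 then 1 else (r * (1 - Real.log r))⁻¹) ^ 2)
  have heq : (fun ζ : ℂ => √(logWeight ζ) * cuspWeight ζ ^ 2) = fun ζ : ℂ =>
      √(1 - Real.log ‖ζ‖) *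
        (if ‖ζ‖ = 0 then 1 else (‖ζ‖ * (1 - Real.log ‖ζ‖))⁻¹) ^ 2 := by
    ext ζ; simp [cuspWeight, logWeight]
  rw [heq, key]
  -- A nonnegative derivative of a function continuous up to the endpoints is integrable. The
  -- primitive is redefined at `0` because `Real.log 0 = 0` would give it the value `2` there
  -- instead of its limit `0`.
  have hd := intervalIntegral.integrableOn_deriv_of_nonneg (a := 0) (b := 1)
    (g := Function.update (fun r => 2 / √(1 - Real.log r)) 0 0)
    (g' := fun r => r * (√(1 - Real.log r) * ((r * (1 - Real.log r))⁻¹) ^ 2)) ?_ ?_ ?_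
  · refine (hd.mono_set Ioo_subset_Ioc_self).congr_fun (fun r hr => ?_) measurableSet_Ioo
    simp [hr.1.ne']
  · rw [continuousOn_update_iff]
    have hu : ∀ r ∈ Icc (0 : ℝ) 1 \ {0}, 0 < 1 - Real.log r := fun r hr => by
      linarith [Real.log_nonpos hr.1.1 hr.1.2]
    refine ⟨?_, fun _ => ?_⟩
    · refine continuousOn_const.div (ContinuousOn.sqrt (continuousOn_const.sub ?_)) fun r hr =>
        (Real.sqrt_pos.2 (hu r hr)).ne'
      exact Real.continuousOn_log.mono fun r hr => hr.2
    · have h1 : Tendsto Real.log (𝓝[Icc (0 : ℝ) 1 \ {0}] 0) atBot :=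
        Real.tendsto_log_nhdsNE_zero.mono_left (nhdsWithin_mono _ fun r hr => hr.2)
      have h2 : Tendsto (fun r => √(1 - Real.log r)) (𝓝[Icc (0 : ℝ) 1 \ {0}] 0) atTop :=
        Real.tendsto_sqrt_atTop.comp
          (tendsto_atTop_add_const_left _ _ (tendsto_neg_atBot_atTop.comp h1))
      exact h2.const_div_atTop 2
  · intro r hr
    refine (hasDerivAt_two_div_sqrt_one_sub_log hr.1 hr.2).congr_of_eventuallyEq ?_
    filter_upwards [isOpen_ne.mem_nhds hr.1.ne'] with s hs
    rw [Function.update_of_ne hs]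
  · intro r hr
    have := hr.1.le
    positivity

theorem integrableOn_logWeightProd_mul_cuspWeightProd (q : ℕ) :
    IntegrableOn (fun z : Fin q → ℂ => logWeightProd z * cuspWeightProd z) (polydisc q) := by
  have h1 : (polydisc q : Set (Fin q → ℂ)) = univ.pi fun _ => Metric.ball 0 1 := by
    ext z; simp [polydisc]
  rw [h1, IntegrableOn, volume_pi, Measure.restrict_pi_pi]
  simp only [logWeightProd, cuspWeightProd, ← Finset.prod_mul_distrib]
  exact Integrable.fintype_prod (f := fun _ ζ => √(logWeight ζ) * cuspWeight ζ ^ 2)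
    fun _ => integrableOn_sqrt_logWeight_mul_cuspWeight_sq

section

/-! ### Directional derivatives of functions -/

/-- The derivative of `f` in the direction `v`, as a function. -/
def dirDeriv {E : Type*} [NormedAddCommGroup E] [NormedSpace ℝ E] (v : E) (f : E → ℝ) : E → ℝ :=
  fun z => fderiv ℝ f z v

section dirDeriv

variable {E : Type*} [NormedAddCommGroup E] [NormedSpace ℝ E] {f g : E → ℝ} {z : E}

theorem contDiff_dirDeriv (v : E) (hf : ContDiff ℝ ∞ f) : ContDiff ℝ ∞ (dirDeriv v f) :=
  (hf.fderiv_right (m := ∞) (by simp)).clm_apply contDiff_const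

theorem dirDeriv_congr (v : E) (h : f =ᶠ[𝓝 z] g) : dirDeriv v f =ᶠ[𝓝 z] dirDeriv v g := by
  filter_upwards [h.fderiv (𝕜 := ℝ)] with w hw
  simp [dirDeriv, hw]

theorem dirDeriv_const (v : E) (c : ℝ) : dirDeriv v (fun _ : E => c) = fun _ => 0 := by
  ext; simp [dirDeriv]

theorem dirDeriv_add (v : E) (hf : ContDiff ℝ ∞ f) (hg : ContDiff ℝ ∞ g) :
    dirDeriv v (fun z => f z + g z) = fun z => dirDeriv v f z + dirDeriv v g z := by
  ext z
  have hf' := hf.differentiable (by simp) z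
  have hg' := hg.differentiable (by simp) z
  simp [dirDeriv, fderiv_fun_add hf' hg']

theorem dirDeriv_mul (v : E) (hf : ContDiff ℝ ∞ f) (hg : ContDiff ℝ ∞ g) :
    dirDeriv v (fun z => f z * g z) = fun z => f z * dirDeriv v g z + g z * dirDeriv v f z := by
  ext z
  have hf' := hf.differentiable (by simp) z
  have hg' := hg.differentiable (by simp) z
  simp [dirDeriv, fderiv_fun_mul hf' hg']

theorem dirDeriv_comm (v w : E) (hf : ContDiff ℝ ∞ f) :
    dirDeriv v (dirDeriv w f) = dirDeriv w (dirDeriv v f) := by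
  ext z
  have h2 : ∀ u : E, fderiv ℝ (dirDeriv u f) z = (fderiv ℝ (fderiv ℝ f) z).flip u := fun u => by
    have hd := ((hf.fderiv_right (m := ∞) (by simp)).differentiable (by simp)) z
    ext w
    unfold dirDeriv
    rw [fderiv_clm_apply hd (differentiableAt_const u)]
    simp
  have hs := (hf.contDiffAt (x := z)).isSymmSndFDerivAt (by
    simp only [minSmoothness_of_isRCLikeNormedField]
    exact WithTop.coe_le_coe.2 (le_top : (2 : ℕ∞) ≤ ⊤))
  rw [dirDeriv, dirDeriv, h2, h2]
  exact hs.eq _ _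

end dirDeriv

/-! ### Logarithmic cutoff functions -/

theorem deriv_smoothTransition_eq_zero {s : ℝ} (hs : s ∉ Icc (0 : ℝ) 1) :
    deriv Real.smoothTransition s = 0 := by
  simp only [mem_Icc, not_and_or, not_le] at hs
  rcases hs with hs | hs
  · rw [EventuallyEq.deriv_eq (f := fun _ => 0), deriv_const]
    filter_upwards [Iio_mem_nhds hs] with t ht
    exact Real.smoothTransition.zero_of_nonpos ht.le
  · rw [EventuallyEq.deriv_eq (f := fun _ => 1), deriv_const]
    filter_upwards [Ioi_mem_nhds hs] with t ht
    exact Real.smoothTransition.one_of_one_le (le_of_lt ht)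

theorem deriv_deriv_smoothTransition_eq_zero {s : ℝ} (hs : s ∉ Icc (0 : ℝ) 1) :
    deriv (deriv Real.smoothTransition) s = 0 := by
  rw [EventuallyEq.deriv_eq (f := fun _ => 0), deriv_const]
  filter_upwards [isClosed_Icc.isOpen_compl.mem_nhds hs] with t ht
  exact deriv_smoothTransition_eq_zero ht

theorem contDiff_deriv_smoothTransition : ContDiff ℝ ∞ (deriv Real.smoothTransition) :=
  (contDiff_infty_iff_deriv.1 Real.smoothTransition.contDiff).2

theorem exists_bound_deriv_smoothTransition : ∃ M, 1 ≤ M ∧ ∀ s,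
    |deriv Real.smoothTransition s| ≤ M ∧ |deriv (deriv Real.smoothTransition) s| ≤ M := by
  obtain ⟨A, hA⟩ := contDiff_deriv_smoothTransition.continuous.bounded_above_of_compact_support
    (HasCompactSupport.intro isCompact_Icc fun s hs => deriv_smoothTransition_eq_zero hs)
  obtain ⟨B, hB⟩ :=
    (contDiff_infty_iff_deriv.1
      contDiff_deriv_smoothTransition).2.continuous.bounded_above_of_compact_support
    (HasCompactSupport.intro isCompact_Icc fun s hs => deriv_deriv_smoothTransition_eq_zero hs)
  exact ⟨max 1 (max A B), le_max_left _ _, fun s =>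
    ⟨(hA s).trans (by simp), (hB s).trans (by simp)⟩⟩

/-- A smooth function on `ℂ`, equal to `0` for `|ζ| ≤ exp (-2N)` and to `1` for
`|ζ| ≥ exp (-N)`. -/
def logCutoff (N : ℝ) (ζ : ℂ) : ℝ :=
  if ζ = 0 then 0 else Real.smoothTransition (2 + Real.log ‖ζ‖ / N)

variable {N : ℝ} {ζ : ℂ}

theorem abs_logCutoff_le_one (N : ℝ) (ζ : ℂ) : |logCutoff N ζ| ≤ 1 := by
  unfold logCutoff
  split_ifs
  · simp
  · rw [abs_of_nonneg (Real.smoothTransition.nonneg _)]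
    exact Real.smoothTransition.le_one _

theorem logCutoff_eventuallyEq_zero (hN : 0 < N) : logCutoff N =ᶠ[𝓝 0] fun _ => 0 := by
  filter_upwards [Metric.ball_mem_nhds (0 : ℂ) (Real.exp_pos (-(2 * N)))] with ζ hζ
  unfold logCutoff
  split_ifs with h
  · rfl
  apply Real.smoothTransition.zero_of_nonpos
  have h1 : Real.log ‖ζ‖ ≤ -(2 * N) :=
    (Real.log_le_iff_le_exp (norm_pos_iff.2 h)).2 (by simpa using (mem_ball_zero_iff.1 hζ).le)
  have : Real.log ‖ζ‖ / N ≤ -2 := by rw [div_le_iff₀ hN]; linarith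
  linarith

theorem logCutoff_eventuallyEq (N : ℝ) (h : ζ ≠ 0) :
    logCutoff N =ᶠ[𝓝 ζ] fun ζ => Real.smoothTransition (2 + Real.log ‖ζ‖ / N) := by
  filter_upwards [isOpen_ne.mem_nhds h] with w hw
  simp [logCutoff, show w ≠ 0 from hw]

theorem contDiff_logCutoff (hN : 0 < N) : ContDiff ℝ ∞ (logCutoff N) := by
  rw [contDiff_iff_contDiffAt]
  intro ζ
  by_cases h : ζ = 0
  · subst h
    exact contDiffAt_const.congr_of_eventuallyEq (logCutoff_eventuallyEq_zero hN)
  · refine ContDiffAt.congr_of_eventuallyEq ?_ (logCutoff_eventuallyEq N h)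
    have h1 : ContDiffAt ℝ ∞ (fun ζ : ℂ => Real.log ‖ζ‖) ζ :=
      (contDiffAt_norm ℝ h).log (norm_ne_zero_iff.2 h)
    exact Real.smoothTransition.contDiff.contDiffAt.comp ζ
      (contDiffAt_const.add (h1.div_const N))

theorem eventually_logCutoff_eventuallyEq_one (h : ζ ≠ 0) :
    ∀ᶠ N : ℝ in atTop, logCutoff N =ᶠ[𝓝 ζ] fun _ => 1 := by
  filter_upwards [eventually_gt_atTop 0, eventually_gt_atTop (-Real.log ‖ζ‖)] with N hN hN'
  have h1 : ContinuousAt (fun ζ : ℂ => Real.log ‖ζ‖) ζ :=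
    continuousAt_id.norm.log (norm_ne_zero_iff.2 h)
  filter_upwards [logCutoff_eventuallyEq N h, h1.eventually_const_lt (by linarith : -N < _)]
    with w hw hw'
  rw [hw]
  apply Real.smoothTransition.one_of_one_le
  have : -1 ≤ Real.log ‖w‖ / N := by rw [le_div_iff₀ hN]; linarith
  linarith

theorem hasFDerivAt_log_norm (h : ζ ≠ 0) :
    HasFDerivAt (fun ζ : ℂ => Real.log ‖ζ‖) ((‖ζ‖ ^ 2)⁻¹ • innerSL ℝ ζ) ζ := by
  have h1 := ((hasStrictFDerivAt_norm_sq ζ).hasFDerivAt.log (by simpa using h)).const_mul (1 / 2)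
  have h2 : (fun ζ : ℂ => (1 / 2) * Real.log (‖ζ‖ ^ 2)) = fun ζ => Real.log ‖ζ‖ := by
    ext w; rw [Real.log_pow]; push_cast; ring
  rw [h2] at h1
  refine h1.congr_fderiv ?_
  ext v; simp; ring

theorem dirDeriv_logCutoff (v : ℂ) (h : ζ ≠ 0) :
    dirDeriv v (logCutoff N) ζ = deriv Real.smoothTransition (2 + Real.log ‖ζ‖ / N) *
      (inner ℝ ζ v / (N * ‖ζ‖ ^ 2)) := by
  have h1 := ((hasFDerivAt_log_norm h).mul_const N⁻¹).const_add 2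
  have h2 := ((Real.smoothTransition.contDiff (n := 1)).differentiable (by simp)
    (2 + Real.log ‖ζ‖ / N)).hasDerivAt.comp_hasFDerivAt ζ h1
  have h3 : HasFDerivAt (logCutoff N) _ ζ := h2.congr_of_eventuallyEq (logCutoff_eventuallyEq N h)
  rw [dirDeriv, h3.fderiv]
  simp only [smul_apply, innerSL_apply_apply, smul_eq_mul]
  rw [div_eq_mul_inv, div_eq_mul_inv, mul_inv]
  ring

theorem dirDeriv_logCutoff_zero (hN : 0 < N) (v : ℂ) : dirDeriv v (logCutoff N) =ᶠ[𝓝 0] 0 := by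
  have := dirDeriv_congr v (logCutoff_eventuallyEq_zero hN)
  rwa [dirDeriv_const] at this

theorem dirDeriv_dirDeriv_logCutoff (v : ℂ) (h : ζ ≠ 0) :
    dirDeriv v (dirDeriv v (logCutoff N)) ζ =
      deriv (deriv Real.smoothTransition) (2 + Real.log ‖ζ‖ / N) *
        (inner ℝ ζ v / (N * ‖ζ‖ ^ 2)) ^ 2 +
      deriv Real.smoothTransition (2 + Real.log ‖ζ‖ / N) * N⁻¹ *
        (‖v‖ ^ 2 / ‖ζ‖ ^ 2 - 2 * inner ℝ ζ v ^ 2 / ‖ζ‖ ^ 4) := by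
  have hn : ‖ζ‖ ≠ 0 := norm_ne_zero_iff.2 h
  have h1 := ((hasFDerivAt_log_norm h).mul_const N⁻¹).const_add 2
  have h2 := (contDiff_deriv_smoothTransition.differentiable (by simp)
    (2 + Real.log ‖ζ‖ / N)).hasDerivAt.comp_hasFDerivAt ζ h1
  have h3 : HasFDerivAt (fun w : ℂ => inner ℝ w v) (innerSL ℝ v) ζ := by
    refine (innerSL ℝ v).hasFDerivAt.congr_of_eventuallyEq (Eventually.of_forall fun w => ?_)
    simp [real_inner_comm]
  have h4 : HasFDerivAt (fun w : ℂ => (‖w‖ ^ 2)⁻¹) _ ζ :=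
    (hasDerivAt_inv (by simpa using h)).comp_hasFDerivAt ζ
      (hasStrictFDerivAt_norm_sq ζ).hasFDerivAt
  have h5 := h2.mul ((h3.mul h4).mul_const N⁻¹)
  have h6 : dirDeriv v (logCutoff N) =ᶠ[𝓝 ζ] fun w =>
      (deriv Real.smoothTransition ∘ fun w : ℂ => 2 + Real.log ‖w‖ * N⁻¹) w *
        ((inner ℝ w v * (‖w‖ ^ 2)⁻¹) * N⁻¹) := by
    filter_upwards [isOpen_ne.mem_nhds h] with w hw
    rw [dirDeriv_logCutoff v hw, Function.comp_apply, ← div_eq_mul_inv, div_eq_mul_inv _ (_ * _),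
      mul_inv]
    ring
  have h7 := h5.congr_of_eventuallyEq h6
  rw [dirDeriv, h7.fderiv]
  simp [real_inner_comm]
  field_simp
  ring

/-- Since `log |ζ|` is harmonic, the terms carrying the first derivative of the step function cancel
between the two directions. What remains has the size of a squared gradient. -/
theorem laplacian_logCutoff (h : ζ ≠ 0) :
    dirDeriv 1 (dirDeriv 1 (logCutoff N)) ζ +
      dirDeriv Complex.I (dirDeriv Complex.I (logCutoff N)) ζ =
      deriv (deriv Real.smoothTransition) (2 + Real.log ‖ζ‖ / N) / (N * ‖ζ‖) ^ 2 := by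
  have hn : ‖ζ‖ ≠ 0 := norm_ne_zero_iff.2 h
  have h1 : ‖ζ‖ ^ 2 = ζ.re ^ 2 + ζ.im ^ 2 := by
    rw [Complex.sq_norm, Complex.normSq_apply]; ring
  rw [dirDeriv_dirDeriv_logCutoff 1 h, dirDeriv_dirDeriv_logCutoff Complex.I h]
  have e1 : inner ℝ ζ 1 = ζ.re := by simp [Complex.inner]
  have e2 : inner ℝ ζ Complex.I = ζ.im := by simp [Complex.inner]
  rw [e1, e2, norm_one, Complex.norm_I]
  have h2 : ζ.im ^ 2 = ‖ζ‖ ^ 2 - ζ.re ^ 2 := by linarith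
  simp only [div_pow, h2]
  by_cases hN : N = 0
  · simp [hN]
  field_simp
  ring

/-- On the transition annulus `-log |ζ| ≤ 2N`, so `1 - log |ζ| ≤ 3N` once `N ≥ 1`. This trades `N`
for a weight independent of `N`. -/
theorem inv_mul_norm_le_cuspWeight (hN : 1 ≤ N) (h : ζ ≠ 0)
    (hs : 2 + Real.log ‖ζ‖ / N ∈ Icc (0 : ℝ) 1) :
    (N * ‖ζ‖)⁻¹ ≤ 3 * cuspWeight ζ := by
  have hN0 : 0 < N := by linarith
  have hn : 0 < ‖ζ‖ := norm_pos_iff.2 h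
  have h1 : -2 ≤ Real.log ‖ζ‖ / N := by linarith [hs.1]
  have h2 : Real.log ‖ζ‖ / N ≤ -1 := by linarith [hs.2]
  rw [le_div_iff₀ hN0] at h1
  rw [div_le_iff₀ hN0] at h2
  have hL : 0 < logWeight ζ := by unfold logWeight; linarith
  have hL' : logWeight ζ ≤ 3 * N := by unfold logWeight; linarith
  rw [cuspWeight, if_neg h, ← div_eq_mul_inv, inv_eq_one_div,
    div_le_div_iff₀ (by positivity) (by positivity)]
  nlinarith

theorem exists_bound_logCutoff : ∃ M, 1 ≤ M ∧ ∀ N, 1 ≤ N → ∀ ζ : ℂ, ‖ζ‖ < 1 →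
    (∀ v : ℂ, ‖v‖ ≤ 1 → |dirDeriv v (logCutoff N) ζ| ≤ M * cuspWeight ζ) ∧
    |dirDeriv 1 (dirDeriv 1 (logCutoff N)) ζ +
      dirDeriv Complex.I (dirDeriv Complex.I (logCutoff N)) ζ| ≤ M * cuspWeight ζ ^ 2 := by
  obtain ⟨A, hA1, hA⟩ := exists_bound_deriv_smoothTransition
  -- The `9` is the square of the `3` in `inv_mul_norm_le_cuspWeight`.
  refine ⟨9 * A, by linarith, fun N hN ζ hζ => ?_⟩
  have hG := one_le_cuspWeight hζ
  by_cases h : ζ = 0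
  · subst h
    have hz := fun v => dirDeriv_logCutoff_zero (by linarith : 0 < N) v
    have hz' := fun v => (dirDeriv_congr v (hz v)).eq_of_nhds
    refine ⟨fun v _ => ?_, ?_⟩
    · rw [(hz v).eq_of_nhds]; simp; positivity
    · have e : ∀ v : ℂ, dirDeriv v (0 : ℂ → ℝ) 0 = 0 := fun v => by
        simp [dirDeriv]
      rw [hz', hz', e, e]; simp; positivity
  have hn : 0 < ‖ζ‖ := norm_pos_iff.2 h
  have hN0 : 0 < N := by linarith
  refine ⟨fun v hv => ?_, ?_⟩
  · rw [dirDeriv_logCutoff v h, abs_mul]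
    by_cases hs : 2 + Real.log ‖ζ‖ / N ∈ Icc (0 : ℝ) 1
    · have h1 : |inner ℝ ζ v / (N * ‖ζ‖ ^ 2)| ≤ (N * ‖ζ‖)⁻¹ := by
        rw [abs_div, abs_of_pos (by positivity : 0 < N * ‖ζ‖ ^ 2)]
        calc _ ≤ (‖ζ‖ * 1) / (N * ‖ζ‖ ^ 2) := by
              gcongr
              exact (abs_real_inner_le_norm ζ v).trans (by gcongr)
          _ = _ := by field_simp
      calc _ ≤ A * (3 * cuspWeight ζ) :=
            mul_le_mul (hA _).1 (h1.trans (inv_mul_norm_le_cuspWeight hN h hs))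
              (abs_nonneg _) (by positivity)
        _ ≤ _ := by nlinarith
    · rw [deriv_smoothTransition_eq_zero hs]; simp; positivity
  · rw [laplacian_logCutoff h, div_eq_mul_inv, abs_mul, ← inv_pow]
    by_cases hs : 2 + Real.log ‖ζ‖ / N ∈ Icc (0 : ℝ) 1
    · have h1 := inv_mul_norm_le_cuspWeight hN h hs
      have h2 : |(N * ‖ζ‖)⁻¹ ^ 2| ≤ (3 * cuspWeight ζ) ^ 2 := by
        rw [abs_of_nonneg (by positivity)]
        gcongr
      calc _ ≤ A * (3 * cuspWeight ζ) ^ 2 :=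
            mul_le_mul (hA _).2 h2 (abs_nonneg _) (by positivity)
        _ = _ := by ring
    · rw [deriv_deriv_smoothTransition_eq_zero hs]; simp; positivity

end

section

/-! ### Cutoff functions along the divisor -/

variable {q : ℕ}

theorem contDiff_prod_apply {f : Fin q → ℂ → ℝ} (hf : ∀ i, ContDiff ℝ ∞ (f i)) :
    ContDiff ℝ ∞ fun z : Fin q → ℂ => ∏ i, f i (z i) :=
  contDiff_prod fun i _ => (hf i).comp (contDiff_apply ℝ ℂ i)

/-- Differentiation preserves the separated form, so estimates for iterated derivatives reduce to
one variable at a time. -/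
theorem dirDeriv_prod_apply {f : Fin q → ℂ → ℝ} (hf : ∀ i, ContDiff ℝ ∞ (f i)) (j : Fin q)
    (v : ℂ) : dirDeriv (Pi.single j v) (fun z : Fin q → ℂ => ∏ i, f i (z i)) =
      fun z => ∏ i, Function.update f j (dirDeriv v (f j)) i (z i) := by
  ext z
  have h1 : ∀ i ∈ Finset.univ, HasFDerivAt (fun z : Fin q → ℂ => f i (z i))
      ((fderiv ℝ (f i) (z i)).comp (ContinuousLinearMap.proj i)) z := fun i _ =>
    ((hf i).differentiable (by simp) (z i)).hasFDerivAt.comp z (hasFDerivAt_apply i z)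
  rw [dirDeriv, (HasFDerivAt.finsetProd h1).fderiv]
  simp only [sum_apply, smul_apply, smul_eq_mul,
    ContinuousLinearMap.comp_apply, ContinuousLinearMap.proj_apply]
  rw [Finset.sum_eq_single j, ← Finset.mul_prod_erase _ _ (Finset.mem_univ j)]
  · rw [Function.update_self, Pi.single_eq_same, mul_comm, dirDeriv]
    congr 1
    refine Finset.prod_congr rfl fun i hi => ?_
    rw [Function.update_of_ne (Finset.ne_of_mem_erase hi)]
  · intro i _ hi
    rw [Pi.single_eq_of_ne hi, map_zero, mul_zero]
  · simp

/-- Four times `∂²ψ/∂z_j∂z̄_k`, for a real function `ψ`. -/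
def mixedDeriv (j k : Fin q) (ψ : (Fin q → ℂ) → ℝ) (z : Fin q → ℂ) : ℂ :=
  ((dirDeriv (Pi.single k 1) (dirDeriv (Pi.single j 1) ψ) z +
      dirDeriv (Pi.single k Complex.I) (dirDeriv (Pi.single j Complex.I) ψ) z : ℝ) : ℂ) +
    Complex.I * ((dirDeriv (Pi.single k Complex.I) (dirDeriv (Pi.single j 1) ψ) z -
      dirDeriv (Pi.single k 1) (dirDeriv (Pi.single j Complex.I) ψ) z : ℝ) : ℂ)

theorem norm_ofReal_add_I_mul_ofReal_le (a b : ℝ) : ‖(a : ℂ) + Complex.I * (b : ℂ)‖ ≤ |a| + |b| :=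
  (norm_add_le _ _).trans (by simp)

theorem mixedDeriv_congr {j k : Fin q} {ψ χ : (Fin q → ℂ) → ℝ} {z : Fin q → ℂ}
    (h : ψ =ᶠ[𝓝 z] χ) : mixedDeriv j k ψ z = mixedDeriv j k χ z := by
  have h2 := fun v w => (dirDeriv_congr w (dirDeriv_congr v h)).eq_of_nhds
  simp only [mixedDeriv, h2]

theorem mixedDeriv_eq_zero_of_notMem_tsupport {j k : Fin q} {ψ : (Fin q → ℂ) → ℝ}
    {z : Fin q → ℂ} (h : z ∉ tsupport ψ) : mixedDeriv j k ψ z = 0 := by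
  rw [mixedDeriv_congr (notMem_tsupport_iff_eventuallyEq.1 h)]
  have e : ∀ v : Fin q → ℂ, dirDeriv v (0 : (Fin q → ℂ) → ℝ) = 0 := fun v => dirDeriv_const v 0
  simp [mixedDeriv, e]

theorem continuous_mixedDeriv (j k : Fin q) {ψ : (Fin q → ℂ) → ℝ} (hψ : ContDiff ℝ ∞ ψ) :
    Continuous (mixedDeriv j k ψ) := by
  have h := fun v w => (contDiff_dirDeriv v (contDiff_dirDeriv w hψ)).continuous
  unfold mixedDeriv
  exact (Complex.continuous_ofReal.comp ((h _ _).add (h _ _))).add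
    (continuous_const.mul (Complex.continuous_ofReal.comp ((h _ _).sub (h _ _))))

/-- The factors of `divisorCutoff`. -/
def cutoffFactor (q l : ℕ) (N : ℝ) (i : Fin q) : ℂ → ℝ :=
  if (i : ℕ) < l then logCutoff N else fun _ => 1

/-- A smooth function that vanishes near the divisor and tends to `1` off it. -/
def divisorCutoff (l : ℕ) (N : ℝ) (z : Fin q → ℂ) : ℝ := ∏ i, cutoffFactor q l N i (z i)

variable {l : ℕ} {N : ℝ}

theorem contDiff_cutoffFactor (hN : 0 < N) (i : Fin q) : ContDiff ℝ ∞ (cutoffFactor q l N i) := by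
  unfold cutoffFactor
  split_ifs
  · exact contDiff_logCutoff hN
  · exact contDiff_const

theorem contDiff_divisorCutoff (hN : 0 < N) :
    ContDiff ℝ ∞ (divisorCutoff (q := q) l N) :=
  contDiff_prod_apply fun i => contDiff_cutoffFactor hN i

theorem abs_cutoffFactor_le_one (i : Fin q) (ζ : ℂ) : |cutoffFactor q l N i ζ| ≤ 1 := by
  unfold cutoffFactor
  split_ifs
  · exact abs_logCutoff_le_one N ζ
  · simp

theorem abs_divisorCutoff_le_one (z : Fin q → ℂ) : |divisorCutoff l N z| ≤ 1 := by
  rw [divisorCutoff, Finset.abs_prod]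
  exact Finset.prod_le_one (fun _ _ => abs_nonneg _) fun i _ => abs_cutoffFactor_le_one i _

theorem divisorCutoff_eventuallyEq_zero (hN : 0 < N) {z : Fin q → ℂ} (hz : z ∈ hyperplanes q l) :
    divisorCutoff l N =ᶠ[𝓝 z] 0 := by
  obtain ⟨k, hk, hzk⟩ := hz
  have h1 : Tendsto (fun w : Fin q → ℂ => w k) (𝓝 z) (𝓝 0) := by
    simpa [hzk] using (continuous_apply k).tendsto z
  filter_upwards [h1.eventually (logCutoff_eventuallyEq_zero hN)] with w hw
  refine Finset.prod_eq_zero (Finset.mem_univ k) ?_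
  simpa [cutoffFactor, hk] using hw

theorem eventually_divisorCutoff_eventuallyEq_one {z : Fin q → ℂ} (hz : z ∉ hyperplanes q l) :
    ∀ᶠ N : ℝ in atTop, divisorCutoff l N =ᶠ[𝓝 z] fun _ => 1 := by
  have h1 : ∀ᶠ N : ℝ in atTop, ∀ i : Fin q, cutoffFactor q l N i =ᶠ[𝓝 (z i)] fun _ => 1 := by
    refine eventually_all.2 fun i => ?_
    unfold cutoffFactor
    split_ifs with hi
    · exact eventually_logCutoff_eventuallyEq_one fun h => hz ⟨i, hi, h⟩
    · exact Eventually.of_forall fun _ => EventuallyEq.rfl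
  filter_upwards [h1] with N hN
  have h2 : ∀ᶠ w in 𝓝 z, ∀ i, cutoffFactor q l N i (w i) = 1 :=
    eventually_all.2 fun i => ((continuous_apply i).tendsto z).eventually (hN i)
  filter_upwards [h2] with w hw
  simp [divisorCutoff, hw]

/-- The bound is wasteful for undifferentiated factors and first derivatives, but having one bound
for all cases lets the factors multiply directly to `cuspWeightProd`. -/
theorem exists_bound_cutoffFactor (q l : ℕ) : ∃ M, 1 ≤ M ∧ ∀ N, 1 ≤ N → ∀ (i : Fin q) (ζ : ℂ),
    ‖ζ‖ < 1 →
    |cutoffFactor q l N i ζ| ≤ M * cuspWeight ζ ^ 2 ∧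
    (∀ v : ℂ, ‖v‖ ≤ 1 → |dirDeriv v (cutoffFactor q l N i) ζ| ≤ M * cuspWeight ζ ^ 2) ∧
    |dirDeriv 1 (dirDeriv 1 (cutoffFactor q l N i)) ζ +
      dirDeriv Complex.I (dirDeriv Complex.I (cutoffFactor q l N i)) ζ| ≤
        M * cuspWeight ζ ^ 2 := by
  obtain ⟨M, hM1, hM⟩ := exists_bound_logCutoff
  refine ⟨M, hM1, fun N hN i ζ hζ => ?_⟩
  have hG := one_le_cuspWeight hζ
  have hG2 : cuspWeight ζ ≤ cuspWeight ζ ^ 2 := by nlinarith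
  refine ⟨(abs_cutoffFactor_le_one i ζ).trans (by nlinarith), ?_⟩
  unfold cutoffFactor
  split_ifs with hi
  · exact ⟨fun v hv => ((hM N hN ζ hζ).1 v hv).trans (by gcongr), (hM N hN ζ hζ).2⟩
  · simp only [dirDeriv_const]
    refine ⟨fun v _ => ?_, ?_⟩ <;> simp <;> positivity

theorem abs_prod_apply_le {M : ℝ} {f : Fin q → ℂ → ℝ} {z : Fin q → ℂ}
    (h : ∀ i, |f i (z i)| ≤ M * cuspWeight (z i) ^ 2) :
    |∏ i, f i (z i)| ≤ M ^ q * cuspWeightProd z := by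
  rw [Finset.abs_prod]
  calc _ ≤ ∏ i, (M * cuspWeight (z i) ^ 2) :=
        Finset.prod_le_prod (fun _ _ => abs_nonneg _) fun i _ => h i
    _ = _ := by simp [Finset.prod_mul_distrib, cuspWeightProd]

theorem exists_bound_divisorCutoff (q l : ℕ) : ∃ M, 1 ≤ M ∧ ∀ N, 1 ≤ N → ∀ z ∈ polydisc q,
    (∀ (j : Fin q) (v : ℂ), ‖v‖ ≤ 1 →
      |dirDeriv (Pi.single j v) (divisorCutoff l N) z| ≤ M * cuspWeightProd z) ∧
    ∀ j k : Fin q, ‖mixedDeriv j k (divisorCutoff l N) z‖ ≤ M * cuspWeightProd z := by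
  obtain ⟨M, hM1, hM⟩ := exists_bound_cutoffFactor q l
  have hMq : 1 ≤ M ^ q := one_le_pow₀ hM1
  refine ⟨4 * M ^ q, by linarith, fun N hN z hz => ?_⟩
  have hN0 : 0 < N := by linarith
  have hW := one_le_cuspWeightProd hz
  set f := cutoffFactor q l N
  have hf : ∀ i, ContDiff ℝ ∞ (f i) := fun i => contDiff_cutoffFactor hN0 i
  have hf' : ∀ j v i, ContDiff ℝ ∞ (Function.update f j (dirDeriv v (f j)) i) := fun j v i => by
    by_cases h : i = j
    · subst h; rw [Function.update_self]; exact contDiff_dirDeriv v (hf i)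
    · rw [Function.update_of_ne h]; exact hf i
  have hχ : divisorCutoff l N = fun z => ∏ i, f i (z i) := rfl
  have b1 : ∀ (j : Fin q) (v : ℂ), ‖v‖ ≤ 1 → ∀ i,
      |Function.update f j (dirDeriv v (f j)) i (z i)| ≤ M * cuspWeight (z i) ^ 2 := by
    intro j v hv i
    by_cases h : i = j
    · subst h; rw [Function.update_self]; exact (hM N hN i _ (hz i)).2.1 v hv
    · rw [Function.update_of_ne h]; exact (hM N hN i _ (hz i)).1
  refine ⟨fun j v hv => ?_, fun j k => ?_⟩
  · rw [hχ, dirDeriv_prod_apply hf]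
    exact (abs_prod_apply_le (b1 j v hv)).trans (by nlinarith)
  -- On the diagonal the mixed terms cancel by symmetry and a Laplacian in one variable remains. Off
  -- the diagonal each of two variables is differentiated once, and the `4` counts the four second
  -- derivatives in `mixedDeriv`.
  by_cases hjk : k = j
  · subst hjk
    have h0 : mixedDeriv k k (divisorCutoff l N) z =
        ((∏ i, Function.update f k (fun ζ => dirDeriv 1 (dirDeriv 1 (f k)) ζ +
          dirDeriv Complex.I (dirDeriv Complex.I (f k)) ζ) i (z i) : ℝ) : ℂ) := by
      rw [mixedDeriv, dirDeriv_comm (Pi.single k Complex.I) (Pi.single k 1)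
        (contDiff_divisorCutoff hN0), sub_self, hχ]
      simp only [dirDeriv_prod_apply hf, dirDeriv_prod_apply (hf' k _), Function.update_self,
        Function.update_idem]
      rw [← Finset.mul_prod_erase _ _ (Finset.mem_univ k),
        ← Finset.mul_prod_erase _ _ (Finset.mem_univ k),
        ← Finset.mul_prod_erase _ _ (Finset.mem_univ k)]
      simp only [Function.update_self]
      have he : ∀ g : ℂ → ℝ, ∏ i ∈ Finset.univ.erase k, Function.update f k g i (z i) =
          ∏ i ∈ Finset.univ.erase k, f i (z i) := fun g =>
        Finset.prod_congr rfl fun i hi => by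
          rw [Function.update_of_ne (Finset.ne_of_mem_erase hi)]
      simp only [he]
      push_cast
      ring
    rw [h0, Complex.norm_real, Real.norm_eq_abs]
    refine (abs_prod_apply_le fun i => ?_).trans
      (by nlinarith : M ^ q * cuspWeightProd z ≤ 4 * M ^ q * cuspWeightProd z)
    by_cases h : i = k
    · subst h; rw [Function.update_self]; exact (hM N hN i _ (hz i)).2.2
    · rw [Function.update_of_ne h]; exact (hM N hN i _ (hz i)).1
  · have b2 : ∀ v w : ℂ, ‖v‖ ≤ 1 → ‖w‖ ≤ 1 →
        |dirDeriv (Pi.single k w) (dirDeriv (Pi.single j v) (divisorCutoff l N)) z| ≤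
          M ^ q * cuspWeightProd z := by
      intro v w hv hw
      rw [hχ, dirDeriv_prod_apply hf, dirDeriv_prod_apply (hf' j v)]
      refine abs_prod_apply_le fun i => ?_
      by_cases h : i = k
      · subst h
        rw [Function.update_self, Function.update_of_ne hjk]
        exact (hM N hN i _ (hz i)).2.1 w hw
      · rw [Function.update_of_ne h]; exact b1 j v hv i
    refine (norm_ofReal_add_I_mul_ofReal_le _ _).trans ?_
    have n1 : ‖(1 : ℂ)‖ ≤ 1 := by simp
    have nI : ‖Complex.I‖ ≤ 1 := by simp
    have t1 := abs_add_le (dirDeriv (Pi.single k 1) (dirDeriv (Pi.single j 1) (divisorCutoff l N)) z)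
      (dirDeriv (Pi.single k Complex.I)
        (dirDeriv (Pi.single j Complex.I) (divisorCutoff l N)) z)
    have t2 := abs_sub (dirDeriv (Pi.single k Complex.I)
        (dirDeriv (Pi.single j 1) (divisorCutoff l N)) z)
      (dirDeriv (Pi.single k 1) (dirDeriv (Pi.single j Complex.I) (divisorCutoff l N)) z)
    have := b2 1 1 n1 n1
    have := b2 1 _ n1 nI
    have := b2 _ 1 nI n1
    have := b2 _ _ nI nI
    linarith

theorem dirDeriv_dirDeriv_mul {E : Type*} [NormedAddCommGroup E] [NormedSpace ℝ E] {f g : E → ℝ}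
    (v w : E) (hf : ContDiff ℝ ∞ f) (hg : ContDiff ℝ ∞ g) (z : E) :
    dirDeriv w (dirDeriv v fun z => f z * g z) z =
      f z * dirDeriv w (dirDeriv v g) z + g z * dirDeriv w (dirDeriv v f) z +
        (dirDeriv v g z * dirDeriv w f z + dirDeriv v f z * dirDeriv w g z) := by
  have hf' := contDiff_dirDeriv v hf
  have hg' := contDiff_dirDeriv v hg
  rw [dirDeriv_mul v hf hg, dirDeriv_add w (hf.mul hg') (hg.mul hf'), dirDeriv_mul w hf hg',
    dirDeriv_mul w hg hf']
  ring

theorem exists_bound_mixedDeriv_mul_divisorCutoff (l : ℕ) (j k : Fin q)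
    {η : (Fin q → ℂ) → ℝ} (hη : ContDiff ℝ ∞ η) (hc : HasCompactSupport η) :
    ∃ C, ∀ N, 1 ≤ N → ∀ z ∈ polydisc q,
      ‖mixedDeriv j k (fun z => η z * divisorCutoff l N z) z‖ ≤ C * cuspWeightProd z := by
  obtain ⟨A, hA⟩ := hη.continuous.bounded_above_of_compact_support hc
  obtain ⟨B, hB⟩ := (hη.continuous_fderiv (by simp)).bounded_above_of_compact_support
    (hc.fderiv ℝ)
  obtain ⟨D, hD⟩ := (continuous_mixedDeriv j k hη).bounded_above_of_compact_support
    (HasCompactSupport.intro hc fun z hz => mixedDeriv_eq_zero_of_notMem_tsupport hz)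
  obtain ⟨M, hM1, hM⟩ := exists_bound_divisorCutoff q l
  -- Leibniz rule: `A * M` when both derivatives fall on the cutoff, `D` when both fall on `η`, and
  -- four cross terms `c v w`, each at most `2 * (M * B)` times the weight.
  refine ⟨A * M + D + 8 * (M * B), fun N hN z hz => ?_⟩
  have hW := one_le_cuspWeightProd hz
  obtain ⟨h1, h2⟩ := hM N hN z hz
  have hχ := contDiff_divisorCutoff (q := q) (l := l) (by linarith : 0 < N)
  set χ := divisorCutoff (q := q) l N
  have hA0 : 0 ≤ A := (norm_nonneg _).trans (hA z)
  have hB0 : 0 ≤ B := (norm_nonneg _).trans (hB z)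
  have hD0 : 0 ≤ D := (norm_nonneg _).trans (hD z)
  have hηv : ∀ (j : Fin q) (v : ℂ), ‖v‖ ≤ 1 → |dirDeriv (Pi.single j v) η z| ≤ B := by
    intro j v hv
    refine ((fderiv ℝ η z).le_opNorm _).trans ?_
    rw [Pi.norm_single]
    calc _ ≤ B * 1 := mul_le_mul (hB z) hv (norm_nonneg _) hB0
      _ = B := mul_one B
  let c : ℂ → ℂ → ℝ := fun v w =>
    dirDeriv (Pi.single j v) χ z * dirDeriv (Pi.single k w) η z +
      dirDeriv (Pi.single j v) η z * dirDeriv (Pi.single k w) χ z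
  have hcb : ∀ v w : ℂ, ‖v‖ ≤ 1 → ‖w‖ ≤ 1 → |c v w| ≤ 2 * (M * B) * cuspWeightProd z := by
    intro v w hv hw
    refine (abs_add_le _ _).trans ?_
    rw [abs_mul, abs_mul]
    have e1 := mul_le_mul (h1 j v hv) (hηv k w hw) (abs_nonneg _) (by positivity)
    have e2 := mul_le_mul (hηv j v hv) (h1 k w hw) (abs_nonneg _) hB0
    linarith
  have hsplit : mixedDeriv j k (fun z => η z * χ z) z = (η z : ℂ) * mixedDeriv j k χ z +
      (χ z : ℂ) * mixedDeriv j k η z + (((c 1 1 + c Complex.I Complex.I : ℝ) : ℂ) +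
        Complex.I * ((c 1 Complex.I - c Complex.I 1 : ℝ) : ℂ)) := by
    simp only [mixedDeriv, dirDeriv_dirDeriv_mul _ _ hη hχ, c]
    push_cast
    ring
  rw [hsplit]
  have n1 : ‖(1 : ℂ)‖ ≤ 1 := by simp
  have nI : ‖Complex.I‖ ≤ 1 := by simp
  have t1 := abs_add_le (c 1 1) (c Complex.I Complex.I)
  have t2 := abs_sub (c 1 Complex.I) (c Complex.I 1)
  have := hcb 1 1 n1 n1
  have := hcb 1 _ n1 nI
  have := hcb _ 1 nI n1
  have := hcb _ _ nI nI
  have t3 := norm_ofReal_add_I_mul_ofReal_le (c 1 1 + c Complex.I Complex.I)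
    (c 1 Complex.I - c Complex.I 1)
  have t4 : ‖(η z : ℂ) * mixedDeriv j k χ z‖ ≤ A * (M * cuspWeightProd z) := by
    rw [norm_mul, Complex.norm_real]
    exact mul_le_mul (hA z) (h2 j k) (norm_nonneg _) hA0
  have t5 : ‖(χ z : ℂ) * mixedDeriv j k η z‖ ≤ D * cuspWeightProd z := by
    rw [norm_mul, Complex.norm_real]
    calc _ ≤ 1 * D := mul_le_mul (abs_divisorCutoff_le_one z) (hD z) (norm_nonneg _) zero_le_one
      _ ≤ D * cuspWeightProd z := by nlinarith
  refine (norm_add_le _ _).trans ((add_le_add_left (norm_add_le _ _) _).trans ?_)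
  linarith

end

variable {q l : ℕ}

/-! ### Consequences of log-log growth -/

theorem exists_log_abs_log_pow_le (p : ℕ) : ∃ A, 1 ≤ A ∧ ∀ ζ : ℂ, ζ ≠ 0 → ‖ζ‖ < Real.exp (-1) →
    |Real.log |Real.log ‖ζ‖| ^ p| ≤ A * √(logWeight ζ) := by
  -- Chosen so that `ε * p ≤ 1 / 2`: after `log s ≤ s ^ ε / ε`, the `p`-th power is absorbed by a
  -- square root.
  set ε : ℝ := 1 / (2 * (p + 1)) with hε
  have hε0 : 0 < ε := by positivity
  have hε1 : ε ≤ 1 := by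
    rw [hε, div_le_one (by positivity)]; linarith [(Nat.cast_nonneg p : (0 : ℝ) ≤ p)]
  refine ⟨(ε⁻¹) ^ p, one_le_pow₀ ((one_le_inv₀ hε0).2 hε1), fun ζ h0 h => ?_⟩
  have hlog : Real.log ‖ζ‖ < -1 := (Real.log_lt_iff_lt_exp (norm_pos_iff.2 h0)).2 h
  rw [abs_of_neg (by linarith : Real.log ‖ζ‖ < 0)]
  set s := -Real.log ‖ζ‖ with hs
  have hs1 : 1 ≤ s := by linarith
  have hls : 0 ≤ Real.log s := Real.log_nonneg hs1
  rw [abs_of_nonneg (pow_nonneg hls p)]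
  calc Real.log s ^ p ≤ (s ^ ε / ε) ^ p := by
        gcongr
        exact Real.log_le_rpow_div (by linarith) hε0
    _ = (ε⁻¹) ^ p * s ^ (ε * p) := by
        rw [div_eq_mul_inv, mul_pow, mul_comm, ← Real.rpow_mul_natCast (by linarith)]
    _ ≤ (ε⁻¹) ^ p * s ^ (1 / 2 : ℝ) := by
        gcongr
        rw [hε, div_mul_eq_mul_div, one_mul, div_le_div_iff₀ (by positivity) (by norm_num)]
        linarith
    _ ≤ (ε⁻¹) ^ p * √(logWeight ζ) := by
        rw [← Real.sqrt_eq_rpow]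
        gcongr
        unfold logWeight; linarith

theorem eventually_branches {x : Fin q → ℂ} :
    ∀ᶠ z in 𝓝[(hyperplanes q l)ᶜ] x, ∀ k : Fin q, (k : ℕ) < l ∧ x k = 0 →
      z k ≠ 0 ∧ ‖z k‖ < Real.exp (-1) := by
  refine eventually_all.2 fun k => ?_
  by_cases hk : (k : ℕ) < l ∧ x k = 0
  · have h1 : ∀ᶠ z : Fin q → ℂ in 𝓝 x, ‖z k‖ < Real.exp (-1) := by
      refine ((continuous_apply k).norm.continuousAt (x := x)).eventually_lt_const ?_
      simp [hk.2, Real.exp_pos]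
    filter_upwards [nhdsWithin_le_nhds h1, self_mem_nhdsWithin] with z hz hz' _
    exact ⟨fun h => hz' ⟨k, hk.1, h⟩, hz⟩
  · exact Eventually.of_forall fun _ h => (hk h).elim

theorem LogLogBoundAt.exists_le_logWeightProd {x : Fin q → ℂ} {f : (Fin q → ℂ) → ℂ}
    (hx : x ∈ polydisc q) (h : LogLogBoundAt l x f) :
    ∃ C, ∀ᶠ z in 𝓝[(hyperplanes q l)ᶜ] x, ‖f z‖ ≤ C * logWeightProd z := by
  classical
  obtain ⟨C, hC, p, h⟩ := h
  obtain ⟨A, hA1, hA⟩ := exists_log_abs_log_pow_le p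
  refine ⟨C * A ^ q + C, ?_⟩
  filter_upwards [h, eventually_branches,
    nhdsWithin_le_nhds ((polydisc q).isOpen.mem_nhds hx)] with z hz hb hzU
  have hL := one_le_logWeightProd hzU
  have hprod : ∏ k ∈ Finset.univ.filter (fun k : Fin q => (k : ℕ) < l ∧ x k = 0),
      Real.log |Real.log ‖z k‖| ^ p ≤ A ^ q * logWeightProd z := by
    refine (le_abs_self _).trans ?_
    rw [Finset.prod_filter, Finset.abs_prod]
    calc _ ≤ ∏ i, (A * √(logWeight (z i))) := by
          refine Finset.prod_le_prod (fun _ _ => abs_nonneg _) fun i _ => ?_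
          split_ifs with hi
          · convert hA (z i) (hb i hi).1 (hb i hi).2 using 1
          · have : 1 ≤ √(logWeight (z i)) := Real.one_le_sqrt.2 (one_le_logWeight (hzU i))
            rw [abs_one]
            nlinarith
      _ = _ := by simp [Finset.prod_mul_distrib, logWeightProd]
  calc ‖f z‖ ≤ _ := hz
    _ ≤ C * (A ^ q * logWeightProd z) + C := by
        gcongr
    _ ≤ _ := by nlinarith

/-- Near a branch `-log |z_k| > 1`, so `1 - log |z_k| ≤ 2 (-log |z_k|)`. It serves to divide by
`zetaFactor` when leaving the frame `dζ`. -/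
theorem one_le_two_mul_cuspWeight_mul_zetaFactor {x z : Fin q → ℂ} (hz : z ∈ polydisc q)
    (hb : ∀ k : Fin q, (k : ℕ) < l ∧ x k = 0 → z k ≠ 0 ∧ ‖z k‖ < Real.exp (-1)) (k : Fin q) :
    1 ≤ 2 * cuspWeight (z k) * ‖zetaFactor l x z k‖ := by
  unfold zetaFactor
  split_ifs with hk
  · obtain ⟨h0, h1⟩ := hb k hk
    have hn : 0 < ‖z k‖ := norm_pos_iff.2 h0
    have hlog : Real.log ‖z k‖ < -1 := (Real.log_lt_iff_lt_exp hn).2 h1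
    have hL := one_le_logWeight (hz k)
    rw [cuspWeight, if_neg h0, norm_mul, Complex.norm_real, Real.norm_eq_abs,
      abs_of_neg (by linarith)]
    have e : 2 * (‖z k‖ * logWeight (z k))⁻¹ * (‖z k‖ * -Real.log ‖z k‖) =
        2 * -Real.log ‖z k‖ / logWeight (z k) := by
      field_simp
    rw [e, one_le_div (by linarith)]
    unfold logWeight
    linarith
  · have := one_le_cuspWeight (hz k)
    rw [norm_one]
    linarith

theorem cuspWeight_sq_le_cuspWeightProd {z : Fin q → ℂ} (hz : z ∈ polydisc q) (k : Fin q) :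
    cuspWeight (z k) ^ 2 ≤ cuspWeightProd z := by
  rw [cuspWeightProd, ← Finset.mul_prod_erase _ _ (Finset.mem_univ k)]
  exact le_mul_of_one_le_right (sq_nonneg _)
    (Finset.one_le_prod fun i _ => one_le_pow₀ (one_le_cuspWeight (hz i)))

theorem mem_puncturedPolydisc {z : Fin q → ℂ} :
    z ∈ (puncturedPolydisc q l : Set (Fin q → ℂ)) ↔ z ∈ polydisc q ∧ z ∉ hyperplanes q l :=
  Iff.rfl

/-- Off the divisor continuity gives local boundedness, which suffices because `B ≥ 1`; only points
of the divisor need the growth hypothesis. -/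
theorem exists_le_of_continuousOn {f : (Fin q → ℂ) → ℂ}
    (hf : ContinuousOn f (puncturedPolydisc q l : Set (Fin q → ℂ)))
    {B : (Fin q → ℂ) → ℝ} (hB : ∀ z ∈ polydisc q, 1 ≤ B z)
    (h : ∀ x ∈ (polydisc q : Set (Fin q → ℂ)) ∩ hyperplanes q l,
      ∃ C, ∀ᶠ z in 𝓝[(hyperplanes q l)ᶜ] x, ‖f z‖ ≤ C * B z)
    {x : Fin q → ℂ} (hx : x ∈ polydisc q) :
    ∃ C, ∀ᶠ z in 𝓝[(puncturedPolydisc q l : Set (Fin q → ℂ))] x, ‖f z‖ ≤ C * B z := by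
  by_cases hxD : x ∈ hyperplanes q l
  · obtain ⟨C, hC⟩ := h x ⟨hx, hxD⟩
    exact ⟨C, nhdsWithin_mono _ (fun z hz => hz.2) hC⟩
  · refine ⟨‖f x‖ + 1, ?_⟩
    have h1 := (hf x (mem_puncturedPolydisc.2 ⟨hx, hxD⟩)).norm.eventually_lt_const
      (lt_add_one ‖f x‖)
    filter_upwards [h1, self_mem_nhdsWithin] with z hz hz'
    have := hB z hz'.1
    nlinarith [norm_nonneg (f x)]

theorem FunctionHasLogLogGrowth.exists_le {f : (Fin q → ℂ) → ℂ}
    (hf : ContinuousOn f (puncturedPolydisc q l : Set (Fin q → ℂ)))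
    (h : FunctionHasLogLogGrowth l f) {x : Fin q → ℂ} (hx : x ∈ polydisc q) :
    ∃ C, ∀ᶠ z in 𝓝[(puncturedPolydisc q l : Set (Fin q → ℂ))] x, ‖f z‖ ≤ C * logWeightProd z :=
  exists_le_of_continuousOn hf (fun _ hz => one_le_logWeightProd hz)
    (fun x hx => (h x hx).exists_le_logWeightProd hx.1) hx

theorem FormHasLogLogGrowth.exists_diag_le {a : (Fin q → ℂ) → Matrix (Fin q) (Fin q) ℂ}
    (h : FormHasLogLogGrowth l a) (j : Fin q) {x : Fin q → ℂ} (hx : x ∈ polydisc q) :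
    ∃ C, ∀ᶠ z in 𝓝[(puncturedPolydisc q l : Set (Fin q → ℂ))] x,
      ‖a z j j‖ ≤ C * (logWeightProd z * cuspWeightProd z) := by
  refine exists_le_of_continuousOn (f := fun z => a z j j) (h.1 j j).continuousOn (fun z hz =>
    one_le_mul_of_one_le_of_one_le (one_le_logWeightProd hz) (one_le_cuspWeightProd hz))
    (fun x hx => ?_) hx
  obtain ⟨C, hC⟩ := (h.2 x hx j j).exists_le_logWeightProd hx.1
  refine ⟨4 * C, ?_⟩
  filter_upwards [hC, eventually_branches,
    nhdsWithin_le_nhds ((polydisc q).isOpen.mem_nhds hx.1)] with z hz hb hzU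
  have h1 := one_le_two_mul_cuspWeight_mul_zetaFactor hzU hb j
  have h2 := cuspWeight_sq_le_cuspWeightProd hzU j
  rw [norm_mul, norm_mul, RCLike.norm_conj] at hz
  set w := ‖zetaFactor l x z j‖
  have hCL : 0 ≤ C * logWeightProd z := le_trans (by positivity) hz
  calc ‖a z j j‖ ≤ ‖a z j j‖ * (2 * cuspWeight (z j) * w) ^ 2 :=
        le_mul_of_one_le_right (norm_nonneg _) (one_le_pow₀ h1)
    _ = 4 * (‖a z j j‖ * w * w) * cuspWeight (z j) ^ 2 := by ring
    _ ≤ 4 * (C * logWeightProd z) * cuspWeightProd z := by gcongr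
    _ = _ := by ring

/-! ### Entry bounds from positivity -/

/-- The determinant of the `2 × 2` submatrix on the indices `j, k` is nonnegative. -/
theorem _root_.Matrix.PosSemidef.norm_apply_sq_le {n : Type*} [Finite n] {A : Matrix n n ℂ}
    (hA : A.PosSemidef) (j k : n) : ‖A j k‖ ^ 2 ≤ ‖A j j‖ * ‖A k k‖ := by
  have h1 := (hA.submatrix ![j, k]).det_nonneg
  rw [Matrix.det_fin_two] at h1
  simp only [Matrix.submatrix_apply, Matrix.cons_val_zero, Matrix.cons_val_one] at h1
  have h2 : A j k * A k j = ((‖A j k‖ ^ 2 : ℝ) : ℂ) := by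
    rw [← hA.1.apply k j, Complex.star_def, Complex.mul_conj']
    push_cast; rfl
  rw [h2, Complex.eq_coe_norm_of_nonneg (hA.diag_nonneg (i := j)),
    Complex.eq_coe_norm_of_nonneg (hA.diag_nonneg (i := k)), ← Complex.ofReal_mul,
    ← Complex.ofReal_sub, Complex.zero_le_real] at h1
  linarith

/-- The matrices of `a - t` and `t + a` have nonnegative diagonals summing to that of `2a`, so both
diagonals are controlled by `a`. Positivity extends the control to all entries, and `2t` is the
difference of the two forms. -/
theorem norm_apply_le_of_isPositive {a t : Matrix (Fin q) (Fin q) ℂ} (h1 : IsPositive (a - t))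
    (h2 : IsPositive (t + a)) (j k : Fin q) : ‖t j k‖ ≤ 2 * ∑ i, ‖a i i‖ := by
  unfold IsPositive at h1 h2
  set S := ∑ i, ‖a i i‖
  have hS : ∀ i, ‖a i i‖ ≤ S := fun i =>
    Finset.single_le_sum (f := fun i => ‖a i i‖) (fun _ _ => norm_nonneg _) (Finset.mem_univ i)
  have hS0 : 0 ≤ S := Finset.sum_nonneg fun _ _ => norm_nonneg _
  set A := -Complex.I • (a - t)
  set B := -Complex.I • (t + a)
  have hsum : ∀ i, ‖A i i‖ + ‖B i i‖ = 2 * ‖a i i‖ := fun i => by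
    have e : A i i + B i i = -Complex.I * (2 * a i i) := by
      simp [A, B]; ring
    have e2 : ‖A i i + B i i‖ = ‖A i i‖ + ‖B i i‖ := by
      rw [Complex.eq_coe_norm_of_nonneg (h1.diag_nonneg (i := i)),
        Complex.eq_coe_norm_of_nonneg (h2.diag_nonneg (i := i)), ← Complex.ofReal_add,
        Complex.norm_real, Complex.norm_real, Complex.norm_real, norm_norm, norm_norm,
        Real.norm_of_nonneg (by positivity)]
    rw [← e2, e]; simp
  have hA : ‖A j k‖ ≤ 2 * S := by
    have := h1.norm_apply_sq_le j k
    have hj := hsum j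
    have hk := hsum k
    have hj' : ‖A j j‖ ≤ 2 * S := by linarith [norm_nonneg (B j j), hS j]
    have hk' : ‖A k k‖ ≤ 2 * S := by linarith [norm_nonneg (B k k), hS k]
    refine abs_le_of_sq_le_sq' ?_ (by positivity) |>.2
    calc _ ≤ _ := this
      _ ≤ (2 * S) * (2 * S) := by gcongr
      _ = _ := by ring
  have hB : ‖B j k‖ ≤ 2 * S := by
    have := h2.norm_apply_sq_le j k
    have hj := hsum j
    have hk := hsum k
    have hj' : ‖B j j‖ ≤ 2 * S := by linarith [norm_nonneg (A j j), hS j]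
    have hk' : ‖B k k‖ ≤ 2 * S := by linarith [norm_nonneg (A k k), hS k]
    refine abs_le_of_sq_le_sq' ?_ (by positivity) |>.2
    calc _ ≤ _ := this
      _ ≤ (2 * S) * (2 * S) := by gcongr
      _ = _ := by ring
  have e : B j k - A j k = -Complex.I * (2 * t j k) := by
    simp [A, B]; ring
  have e2 : ‖B j k - A j k‖ = 2 * ‖t j k‖ := by rw [e]; simp
  have := norm_sub_le (B j k) (A j k)
  linarith

/-! ### Local integrability of extensions by zero -/

/-- A function on `V` that is bounded, locally on `U`, by multiples of a locally integrable
function on `U` has a locally integrable extension by zero. -/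
theorem locallyIntegrableOn_indicator_of_le {X : Type*} [TopologicalSpace X] [MeasurableSpace X]
    [OpensMeasurableSpace X] {μ : Measure X} {U V : Set X} {f : X → ℂ} {g B : X → ℝ}
    (hV : MeasurableSet V) (hf : AEStronglyMeasurable f (μ.restrict V))
    (hB : LocallyIntegrableOn B U μ) (hfg : ∀ᵐ z ∂μ.restrict V, ‖f z‖ ≤ g z)
    (hg : ∀ x ∈ U, ∃ C, ∀ᶠ z in 𝓝[V] x, g z ≤ C * B z) :
    LocallyIntegrableOn (V.indicator f) U μ := by
  intro x hx
  obtain ⟨C, hC⟩ := hg x hx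
  obtain ⟨O, hO, hxO, hOV⟩ := mem_nhdsWithin.1 hC
  obtain ⟨s, hs, hBs⟩ := hB x hx
  refine ⟨s ∩ O, inter_mem hs (nhdsWithin_le_nhds (hO.mem_nhds hxO)), ?_⟩
  have hB' : IntegrableOn B (s ∩ O) μ := hBs.mono_set inter_subset_left
  refine (hB'.const_mul C).mono ((aestronglyMeasurable_indicator_iff hV).2 hf).restrict ?_
  have h1 : ∀ᵐ z ∂μ.restrict (s ∩ O), z ∈ O :=
    ae_restrict_of_ae_restrict_of_subset inter_subset_right (ae_restrict_mem hO.measurableSet)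
  have h2 : ∀ᵐ z ∂μ.restrict (s ∩ O), z ∈ V → ‖f z‖ ≤ g z :=
    ae_restrict_of_ae ((ae_restrict_iff' hV).1 hfg)
  filter_upwards [h1, h2] with z hzO hz
  by_cases hzV : z ∈ V
  · rw [indicator_of_mem hzV]
    exact (hz hzV).trans ((hOV ⟨hzO, hzV⟩).trans (le_abs_self _))
  · rw [indicator_of_notMem hzV, norm_zero]
    exact norm_nonneg _

theorem locallyIntegrableOn_weights (q : ℕ) : LocallyIntegrableOn
    (fun z : Fin q → ℂ => logWeightProd z * cuspWeightProd z) (polydisc q : Set (Fin q → ℂ)) :=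
  (integrableOn_logWeightProd_mul_cuspWeightProd q).locallyIntegrableOn

/-- Supplies the dominating function for `f` times the second derivatives of the cutoff test
functions. -/
theorem locallyIntegrableOn_indicator_mul_cuspWeightProd {f : (Fin q → ℂ) → ℂ}
    (hf : ContinuousOn f (puncturedPolydisc q l : Set (Fin q → ℂ)))
    (h : FunctionHasLogLogGrowth l f) :
    LocallyIntegrableOn ((puncturedPolydisc q l : Set (Fin q → ℂ)).indicator
      fun z => f z * (cuspWeightProd z : ℂ)) (polydisc q : Set (Fin q → ℂ)) := by
  have hV := (puncturedPolydisc q l).isOpen.measurableSet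
  refine locallyIntegrableOn_indicator_of_le hV ((hf.aestronglyMeasurable hV).mul
    (Complex.measurable_ofReal.comp measurable_cuspWeightProd).aestronglyMeasurable)
    (locallyIntegrableOn_weights q) (Eventually.of_forall fun z => le_rfl) fun x hx => ?_
  obtain ⟨C, hC⟩ := h.exists_le hf hx
  refine ⟨C, hC.mono fun z hz => ?_⟩
  rw [norm_mul, Complex.norm_real, Real.norm_of_nonneg (cuspWeightProd_nonneg z), ← mul_assoc]
  exact mul_le_mul_of_nonneg_right hz (cuspWeightProd_nonneg z)

theorem locallyIntegrableOn_indicator_of_functionHasLogLogGrowth {f : (Fin q → ℂ) → ℂ}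
    (hf : ContinuousOn f (puncturedPolydisc q l : Set (Fin q → ℂ)))
    (h : FunctionHasLogLogGrowth l f) :
    LocallyIntegrableOn ((puncturedPolydisc q l : Set (Fin q → ℂ)).indicator f)
      (polydisc q : Set (Fin q → ℂ)) := by
  have hV := (puncturedPolydisc q l).isOpen.measurableSet
  refine locallyIntegrableOn_indicator_of_le hV (hf.aestronglyMeasurable hV)
    (locallyIntegrableOn_weights q) (Eventually.of_forall fun z => le_rfl) fun x hx => ?_
  obtain ⟨C, hC⟩ := h.exists_le hf hx
  refine ⟨C, ?_⟩
  filter_upwards [hC, self_mem_nhdsWithin] with z hz hzV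
  have h1 := one_le_cuspWeightProd hzV.1
  have h2 : 0 ≤ C * logWeightProd z := (norm_nonneg _).trans hz
  rw [← mul_assoc]
  exact hz.trans (le_mul_of_one_le_right h2 h1)

/-! ### Currents given by functions -/

variable {Ω : Opens (Fin q → ℂ)}

theorem coe_lineDerivOp (v : Fin q → ℂ) (ψ : 𝓓(Ω, ℝ)) : ⇑(∂_{v} ψ : 𝓓(Ω, ℝ)) = dirDeriv v ψ := by
  ext z
  rw [TestFunction.lineDerivOp_eq_lineDerivCLM ℝ, TestFunction.lineDerivCLM_eq_fderivCLM,
    TestFunction.fderivCLM_apply_of_le _ (by simp)]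
  rfl

theorem ofFunction_apply {f : (Fin q → ℂ) → ℂ} (hf : LocallyIntegrableOn f Ω) (ψ : 𝓓(Ω, ℝ)) :
    ofFunction Ω f ψ = ∫ z, (ψ z : ℂ) * f z := by
  refine (TestFunction.integralAgainstBilinCLM_eq_integral hf).trans ?_
  simp

theorem integrable_mul_of_locallyIntegrableOn {f : (Fin q → ℂ) → ℂ} (hf : LocallyIntegrableOn f Ω)
    (ψ : 𝓓(Ω, ℝ)) : Integrable fun z => (ψ z : ℂ) * f z := by
  simpa using ψ.integrable_bilin (ContinuousLinearMap.lsmul ℝ ℝ : ℝ →L[ℝ] ℂ →L[ℝ] ℂ) hf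

theorem del_delBar_apply (u : Current00 Ω) (j k : Fin q) (ψ : 𝓓(Ω, ℝ)) :
    del (delBar u) j k ψ = (1 / 4 : ℂ) * (
      (u (∂_{(Pi.single k 1 : Fin q → ℂ)} (∂_{(Pi.single j 1 : Fin q → ℂ)} ψ)) +
        u (∂_{(Pi.single k Complex.I : Fin q → ℂ)} (∂_{(Pi.single j Complex.I : Fin q → ℂ)} ψ))) +
      Complex.I *
        (u (∂_{(Pi.single k Complex.I : Fin q → ℂ)} (∂_{(Pi.single j 1 : Fin q → ℂ)} ψ)) -
        u (∂_{(Pi.single k 1 : Fin q → ℂ)} (∂_{(Pi.single j Complex.I : Fin q → ℂ)} ψ)))) := by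
  simp only [del, delBar, wirtinger, wirtingerBar, smul_apply, sub_apply, add_apply,
    Distribution.lineDerivOp_apply_apply, map_neg, smul_eq_mul]
  linear_combination (-1 / 4 * u (∂_{(Pi.single k Complex.I : Fin q → ℂ)}
    (∂_{(Pi.single j Complex.I : Fin q → ℂ)} ψ))) * Complex.I_sq

theorem del_delBar_ofFunction_apply {f : (Fin q → ℂ) → ℂ} (hf : LocallyIntegrableOn f Ω)
    (j k : Fin q) (ψ : 𝓓(Ω, ℝ)) :
    del (delBar (ofFunction Ω f)) j k ψ = (1 / 4 : ℂ) * ∫ z, mixedDeriv j k ψ z * f z := by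
  rw [del_delBar_apply]
  have hi := fun χ : 𝓓(Ω, ℝ) => integrable_mul_of_locallyIntegrableOn hf χ
  have hadd : ∀ χ χ' : 𝓓(Ω, ℝ), Integrable fun z => (χ z : ℂ) * f z + (χ' z : ℂ) * f z :=
    fun χ χ' => (hi χ).add (hi χ')
  have hsub : ∀ χ χ' : 𝓓(Ω, ℝ), Integrable fun z => (χ z : ℂ) * f z - (χ' z : ℂ) * f z :=
    fun χ χ' => (hi χ).sub (hi χ')
  simp only [ofFunction_apply hf]
  rw [← integral_add (hi _) (hi _), ← integral_sub (hi _) (hi _), ← integral_const_mul,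
    ← integral_add (hadd _ _) ((hsub _ _).const_mul _)]
  congr 1
  refine integral_congr_ae (Eventually.of_forall fun z => ?_)
  simp only [coe_lineDerivOp, mixedDeriv]
  push_cast
  ring

/-- By the fundamental lemma of the calculus of variations. It transfers the bounds on the
representative in the growth hypothesis to every other one. -/
theorem IsRepresentedBy.ae_eq {T : Current11 Ω} {s t : (Fin q → ℂ) → Matrix (Fin q) (Fin q) ℂ}
    (hs : IsRepresentedBy T s) (ht : IsRepresentedBy T t) (j k : Fin q) :
    ∀ᵐ z ∂volume.restrict (Ω : Set (Fin q → ℂ)), s z j k = t z j k := by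
  obtain ⟨hs1, hs2⟩ := hs j k
  obtain ⟨ht1, ht2⟩ := ht j k
  rw [ae_restrict_iff' Ω.isOpen.measurableSet]
  have h := Ω.isOpen.ae_eq_zero_of_integral_contDiff_smul_eq_zero (hs1.sub ht1)
    fun g hg hc hsupp => by
      let ψ : 𝓓(Ω, ℝ) := ⟨g, hg, hc, hsupp⟩
      have e : ofFunction Ω (fun z => s z j k) ψ = ofFunction Ω (fun z => t z j k) ψ := by
        rw [← hs2, ← ht2]
      rw [ofFunction_apply hs1, ofFunction_apply ht1] at e
      have := integral_sub (integrable_mul_of_locallyIntegrableOn hs1 ψ)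
        (integrable_mul_of_locallyIntegrableOn ht1 ψ)
      rw [e, sub_self] at this
      rw [← this]
      refine integral_congr_ae (Eventually.of_forall fun z => ?_)
      simp only [Pi.sub_apply, Complex.real_smul, mul_sub]
      rfl
  filter_upwards [h] with z hz hzΩ
  exact sub_eq_zero.1 (hz hzΩ)

theorem CurrentHasLogLogGrowth.locallyIntegrableOn_indicator
    {T : Current11 (puncturedPolydisc q l)} (hT : CurrentHasLogLogGrowth T)
    {t : (Fin q → ℂ) → Matrix (Fin q) (Fin q) ℂ} (ht : IsRepresentedBy T t) (j k : Fin q) :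
    LocallyIntegrableOn ((puncturedPolydisc q l : Set (Fin q → ℂ)).indicator fun z => t z j k)
      (polydisc q : Set (Fin q → ℂ)) := by
  obtain ⟨s, a, hs, ha, hsa⟩ := hT
  have hV := (puncturedPolydisc q l).isOpen.measurableSet
  refine locallyIntegrableOn_indicator_of_le (g := fun z => 2 * ∑ i, ‖a z i i‖) hV
    (ht j k).1.aestronglyMeasurable (locallyIntegrableOn_weights q) ?_ fun x hx => ?_
  · filter_upwards [hsa, hs.ae_eq ht j k] with z hz hst
    rw [← hst]
    exact norm_apply_le_of_isPositive hz.1 hz.2 j k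
  · choose C hC using fun i => ha.exists_diag_le i hx
    refine ⟨2 * ∑ i, C i, ?_⟩
    filter_upwards [eventually_all.2 hC] with z hz
    rw [mul_assoc, Finset.sum_mul]
    exact mul_le_mul_of_nonneg_left (Finset.sum_le_sum fun i _ => hz i) zero_le_two

/-! ### Passage to the limit -/

/-- The product of a test function on the polydisc with a cutoff function along the divisor. -/
def cutoffTestFunction (l : ℕ) {N : ℝ} (hN : 0 < N) (η : 𝓓(polydisc q, ℝ)) :
    𝓓(puncturedPolydisc q l, ℝ) where
  toFun z := η z * divisorCutoff l N z
  contDiff' := η.contDiff.mul (contDiff_divisorCutoff hN)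
  hasCompactSupport' := η.hasCompactSupport.mul_right
  tsupport_subset' z hz := by
    refine ⟨η.tsupport_subset (closure_mono (Function.support_mul_subset_left _ _) hz),
      fun hzD => ?_⟩
    refine notMem_tsupport_iff_eventuallyEq.2 ?_ hz
    filter_upwards [divisorCutoff_eventuallyEq_zero hN hzD] with w hw
    simp [hw]

theorem coe_cutoffTestFunction {N : ℝ} (hN : 0 < N) (η : 𝓓(polydisc q, ℝ)) :
    ⇑(cutoffTestFunction l hN η) = fun z => η z * divisorCutoff l N z :=
  rfl

theorem tendsto_integral_cutoff_mul {f : (Fin q → ℂ) → ℂ}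
    (hf : LocallyIntegrableOn ((puncturedPolydisc q l : Set (Fin q → ℂ)).indicator f)
      (polydisc q : Set (Fin q → ℂ))) (η : 𝓓(polydisc q, ℝ)) :
    Tendsto (fun n : ℕ => ∫ z, (cutoffTestFunction l n.cast_add_one_pos η z : ℂ) * f z) atTop
      (𝓝 (∫ z, (η z : ℂ) * (puncturedPolydisc q l : Set (Fin q → ℂ)).indicator f z)) := by
  set V := (puncturedPolydisc q l : Set (Fin q → ℂ))
  have hint := integrable_mul_of_locallyIntegrableOn hf η
  -- The values of `f` off `V` are arbitrary but irrelevant, since the cutoff test function is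
  -- supported in `V`.
  have heq : ∀ (n : ℕ) z, (cutoffTestFunction l n.cast_add_one_pos η z : ℂ) * f z =
      (divisorCutoff l (n + 1) z : ℂ) * ((η z : ℂ) * V.indicator f z) := by
    intro n z
    by_cases hz : z ∈ V
    · rw [indicator_of_mem hz, coe_cutoffTestFunction]
      push_cast; ring
    · rw [indicator_of_notMem hz, image_eq_zero_of_notMem_tsupport fun h =>
        hz ((cutoffTestFunction l n.cast_add_one_pos η).tsupport_subset h)]
      simp
  simp only [heq]
  refine tendsto_integral_of_dominated_convergence _ (fun n => ?_) hint.norm (fun n => ?_) ?_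
  · exact (Complex.continuous_ofReal.comp
      (contDiff_divisorCutoff n.cast_add_one_pos).continuous).aestronglyMeasurable.mul
      hint.aestronglyMeasurable
  · refine Eventually.of_forall fun z => ?_
    rw [norm_mul, Complex.norm_real]
    exact mul_le_of_le_one_left (norm_nonneg _) (abs_divisorCutoff_le_one z)
  · refine Eventually.of_forall fun z => ?_
    by_cases hz : z ∈ V
    · refine tendsto_const_nhds.congr' ?_
      have h := (tendsto_natCast_atTop_atTop (R := ℝ)).atTop_add (tendsto_const_nhds (x := 1))
        |>.eventually (eventually_divisorCutoff_eventuallyEq_one hz.2)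
      filter_upwards [h] with n hn
      rw [hn.eq_of_nhds]; simp
    · simp [indicator_of_notMem hz]

theorem tendsto_integral_mixedDeriv_cutoff_mul {f : (Fin q → ℂ) → ℂ}
    (hf : ContinuousOn f (puncturedPolydisc q l : Set (Fin q → ℂ)))
    (h : FunctionHasLogLogGrowth l f) (j k : Fin q) (η : 𝓓(polydisc q, ℝ)) :
    Tendsto (fun n : ℕ =>
        ∫ z, mixedDeriv j k (cutoffTestFunction l n.cast_add_one_pos η) z * f z) atTop
      (𝓝 (∫ z, mixedDeriv j k η z *
        (puncturedPolydisc q l : Set (Fin q → ℂ)).indicator f z)) := by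
  set V := (puncturedPolydisc q l : Set (Fin q → ℂ))
  have hV : MeasurableSet V := (puncturedPolydisc q l).isOpen.measurableSet
  have hη : ContDiff ℝ ∞ η := η.contDiff
  have heq : ∀ (n : ℕ) z, mixedDeriv j k (cutoffTestFunction l n.cast_add_one_pos η) z * f z =
      mixedDeriv j k (cutoffTestFunction l n.cast_add_one_pos η) z * V.indicator f z := by
    intro n z
    by_cases hz : z ∈ V
    · rw [indicator_of_mem hz]
    · rw [mixedDeriv_eq_zero_of_notMem_tsupport fun h =>
        hz ((cutoffTestFunction l n.cast_add_one_pos η).tsupport_subset h)]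
      simp
  simp only [heq]
  obtain ⟨C, hC⟩ := exists_bound_mixedDeriv_mul_divisorCutoff l j k hη η.hasCompactSupport
  have hint : IntegrableOn (V.indicator fun z => f z * (cuspWeightProd z : ℂ)) (tsupport η) :=
    (locallyIntegrableOn_indicator_mul_cuspWeightProd hf h).integrableOn_compact_subset
      η.tsupport_subset η.hasCompactSupport
  -- The majorant is independent of `n`. Restricting it to the compact support of `η` turns local
  -- integrability on `U` into integrability.
  have hbd := (hint.integrable_indicator (isClosed_tsupport η).measurableSet).norm.const_mul C
  refine tendsto_integral_of_dominated_convergence _ (fun n => ?_) hbd (fun n => ?_) ?_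
  · refine AEStronglyMeasurable.mul ?_
      ((aestronglyMeasurable_indicator_iff hV).2 (hf.aestronglyMeasurable hV))
    exact (continuous_mixedDeriv j k
      (cutoffTestFunction l n.cast_add_one_pos η).contDiff).aestronglyMeasurable
  · refine Eventually.of_forall fun z => ?_
    by_cases hzη : z ∈ tsupport η
    · rw [indicator_of_mem hzη]
      by_cases hz : z ∈ V
      · rw [indicator_of_mem hz, indicator_of_mem hz, norm_mul, norm_mul, Complex.norm_real,
          Real.norm_of_nonneg (cuspWeightProd_nonneg z)]
        -- The parameters are `n + 1` because the uniform bound requires `N ≥ 1`.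
        have h1 := hC (n + 1) (by linarith [(Nat.cast_nonneg n : (0 : ℝ) ≤ n)]) z hz.1
        rw [coe_cutoffTestFunction]
        calc _ ≤ C * cuspWeightProd z * ‖f z‖ := by gcongr
          _ = _ := by ring
      · simp [indicator_of_notMem hz]
    · rw [indicator_of_notMem hzη, coe_cutoffTestFunction, mixedDeriv_eq_zero_of_notMem_tsupport fun h =>
        hzη (closure_mono (Function.support_mul_subset_left _ _) h)]
      simp
  · refine Eventually.of_forall fun z => ?_
    by_cases hz : z ∈ V
    · refine tendsto_const_nhds.congr' ?_
      have h := (tendsto_natCast_atTop_atTop (R := ℝ)).atTop_add (tendsto_const_nhds (x := 1))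
        |>.eventually (eventually_divisorCutoff_eventuallyEq_one hz.2)
      filter_upwards [h] with n hn
      congr 1
      refine mixedDeriv_congr ?_
      filter_upwards [hn] with w hw
      simp [coe_cutoffTestFunction, hw]
    · simp [indicator_of_notMem hz]

end LogLogCurrents

end

/-! ### The extension theorem -/

theorem mainTheorem11 (q l : ℕ) (hl : l ≤ q) (φ : (Fin q → ℂ) → ℝ)
    (hφ : ContinuousOn φ (LogLogCurrents.puncturedPolydisc q l))
    (hφ_growth : LogLogCurrents.FunctionHasLogLogGrowth l fun z => (φ z : ℂ))
    (T : LogLogCurrents.Current11 (LogLogCurrents.puncturedPolydisc q l))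
    (hT : T = (1 / (2 * Real.pi * Complex.I) : ℂ) •
      LogLogCurrents.del (LogLogCurrents.delBar
        (LogLogCurrents.ofFunction (LogLogCurrents.puncturedPolydisc q l) fun z => (φ z : ℂ))))
    (hT_growth : LogLogCurrents.CurrentHasLogLogGrowth T) :
    let φ₀ : (Fin q → ℂ) → ℂ :=
      (LogLogCurrents.puncturedPolydisc q l : Set (Fin q → ℂ)).indicator fun z => (φ z : ℂ)
    MeasureTheory.LocallyIntegrableOn φ₀ (LogLogCurrents.polydisc q) ∧
      LogLogCurrents.IsL1Extension T ((1 / (2 * Real.pi * Complex.I) : ℂ) •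
        LogLogCurrents.del (LogLogCurrents.delBar
          (LogLogCurrents.ofFunction (LogLogCurrents.polydisc q) φ₀))) := by
  intro φ₀
  have hf : ContinuousOn (fun z => (φ z : ℂ))
      (LogLogCurrents.puncturedPolydisc q l : Set (Fin q → ℂ)) :=
    Complex.continuous_ofReal.comp_continuousOn hφ
  have hφ₀ := LogLogCurrents.locallyIntegrableOn_indicator_of_functionHasLogLogGrowth hf hφ_growth
  refine ⟨hφ₀, ?_, fun t ht j k => ?_⟩
  · obtain ⟨t, -, ht, -⟩ := hT_growth
    exact ⟨t, ht⟩
  have ht₀ := hT_growth.locallyIntegrableOn_indicator ht j k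
  have hind : (fun z => (LogLogCurrents.puncturedPolydisc q l : Set (Fin q → ℂ)).indicator t z j k)
      = (LogLogCurrents.puncturedPolydisc q l : Set (Fin q → ℂ)).indicator fun z => t z j k := by
    ext z
    by_cases hz : z ∈ (LogLogCurrents.puncturedPolydisc q l : Set (Fin q → ℂ)) <;> simp [hz]
  rw [hind]
  refine ⟨ht₀, ?_⟩
  ext η
  rw [LogLogCurrents.ofFunction_apply ht₀]
  simp only [Pi.smul_apply, smul_apply, smul_eq_mul]
  rw [LogLogCurrents.del_delBar_ofFunction_apply hφ₀]
  -- Both sides are limits of one sequence, the values of `T j k` on the cutoff test functions,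
  -- computed once from `t` and once from `φ`.
  refine tendsto_nhds_unique ?_ (LogLogCurrents.tendsto_integral_cutoff_mul ht₀ η)
  refine (((LogLogCurrents.tendsto_integral_mixedDeriv_cutoff_mul hf hφ_growth j k η).const_mul
    (1 / 4 : ℂ)).const_mul (1 / (2 * Real.pi * Complex.I) : ℂ)).congr fun n => ?_
  have hloc := hf.locallyIntegrableOn (μ := volume)
    (LogLogCurrents.puncturedPolydisc q l).isOpen.measurableSet
  rw [← LogLogCurrents.del_delBar_ofFunction_apply hloc, ← LogLogCurrents.ofFunction_apply
    (ht j k).1, ← (ht j k).2, hT]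
  rfl
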